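/- Let $\omega>0$, let $J$ be a non-zero purely imaginary number, and let $q$ and $w$ be real distributions of order $0$ on $\mathbb R$, both periodic with period $\omega$ (that is, $r(\phi)=r(\phi(\cdot+\omega))$ for every test function $\phi$ and $r\in\{q,w\}$), with $w$ non-negative and $w\neq0$. (A distribution $r$ has order $0$ if for every compact $K\subset\mathbb R$ there is $C\ge 0$ with $|r(\phi)|\le C\|\phi\|_\infty$ for all test functions $\phi$ supported in $K$; it is identified with the local signed measure representing it, and $rf$ denotes the distribution $\phi\mapsto\int f\phi\,dr$.) Let $L^2(w)$ be the Hilbert space of classes $[f]$ of complex-valued measurable functions with $\int|f|^2\,dw<\infty$, with inner product $\langle f,g\rangle=\int\overline f g\,dw$, and let $$T_{\max}=\{([u],[f])\in L^2(w)\times L^2(w): u\in \mathrm{BV}^{\#}_{\rm loc}(\mathbb R),\ Ju'+qu=wf\},$$ where $\mathrm{BV}^{\#}_{\rm loc}(\mathbb R)$ is the set of functions $u:\mathbb R\to\mathbb C$ of locally bounded variation with $u=(u^++u^-)/2$ everywhere ($u^\pm$ being the right- and left-hand limits), and the equation holds in the sense of distributions. Then the linear relation $T_{\max}$ is self-adjoint,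 i.e. it coincides with $T_{\max}^*=\{(v,g)\in L^2(w)\times L^2(w):\langle f,v\rangle=\langle u,g\rangle \text{ for all } (u,f)\in T_{\max}\}$. Its spectrum, the complement of the set of those $\lambda\in\mathbb C$ for which $\ker(T_{\max}-\lambda)=\{0\}$ and $\operatorname{ran}(T_{\max}-\lambda)=L^2(w)$, is the whole real line $\mathbb R$. The spectrum is purely continuous: for each of its points $\lambda$, $\ker(T_{\max}-\lambda)=\{0\}$, and $\operatorname{ran}(T_{\max}-\lambda)$ is dense in, but not equal to, $L^2(w)$. -/

import Mathlib

namespace PeriodicSystem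

open MeasureTheory Set Function

/-! ### Real distributions of order zero on the real line -/

/-- Real-valued test functions on the real line. -/
abbrev Test : Type := TestFunction (⊤ : TopologicalSpace.Opens ℝ) ℝ ⊤

/-- Real distributions on the real line. -/
abbrev RealDistribution : Type := Distribution (⊤ : TopologicalSpace.Opens ℝ) ℝ ⊤

/-- `r` has order `0`: on every compact set it is bounded by a multiple of the sup norm. -/
def HasOrderZero (r : RealDistribution) : Prop :=
  ∀ K : Set ℝ, IsCompact K →
    ∃ C : ℝ, 0 ≤ C ∧ ∀ φ : Test, tsupport φ ⊆ K → |r φ| ≤ C * ⨆ x, |φ x|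

/-- `ω` is a period of `r`: `r(φ) = r(φ(· + ω))` for every test function `φ`. -/
def HasPeriod (r : RealDistribution) (ω : ℝ) : Prop :=
  ∀ φ ψ : Test, (∀ x, ψ x = φ (x + ω)) → r φ = r ψ

/-- `r` is non-negative: it is non-negative on non-negative test functions. -/
def IsNonneg (r : RealDistribution) : Prop :=
  ∀ φ : Test, (∀ x, 0 ≤ φ x) → 0 ≤ r φ

/-- `μ` and `ν` are the positive and negative parts of the local (signed) measure which
represents the distribution `r`. -/
structure IsJordanPair (r : RealDistribution) (μ ν : Measure ℝ) : Prop where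
  locallyFinite_pos : IsLocallyFiniteMeasure μ
  locallyFinite_neg : IsLocallyFiniteMeasure ν
  mutuallySingular : μ ⟂ₘ ν
  apply_eq : ∀ φ : Test, r φ = ∫ x, φ x ∂μ - ∫ x, φ x ∂ν

/-- The pair `(r⁺, r⁻)` of the positive and negative parts of the local measure of a real
distribution of order `0`. By Riesz' theorem it exists, and it is unique, exactly if `r` has
order `0`; it is `(0, 0)` by convention for the other distributions. -/
noncomputable def jordanPair (r : RealDistribution) : Measure ℝ × Measure ℝ :=
  open Classical in
  if h : ∃ m : Measure ℝ × Measure ℝ, IsJordanPair r m.1 m.2 then h.choose else (0, 0)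

/-- The positive Borel measure of a non-negative distribution. By Riesz' theorem there is exactly
one locally finite measure which represents such a distribution; for other distributions the
value is `0` by convention. -/
noncomputable def toMeasure (r : RealDistribution) : Measure ℝ :=
  open Classical in
  if h : ∃ μ : Measure ℝ, IsLocallyFiniteMeasure μ ∧ ∀ φ : Test, r φ = ∫ x, φ x ∂μ
  then h.choose else 0

instance (r : RealDistribution) : IsLocallyFiniteMeasure (jordanPair r).1 := by
  unfold jordanPair
  split_ifs with h
  · exact h.choose_spec.locallyFinite_pos
  · infer_instance

instance (r : RealDistribution) : IsLocallyFiniteMeasure (jordanPair r).2 := by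
  unfold jordanPair
  split_ifs with h
  · exact h.choose_spec.locallyFinite_neg
  · infer_instance

instance (r : RealDistribution) : IsLocallyFiniteMeasure (toMeasure r) := by
  unfold toMeasure
  split_ifs with h
  · exact h.choose_spec.1
  · infer_instance

/-! ### Balanced functions of locally bounded variation -/

/-- Balanced functions of locally bounded variation: at every point, the value is the mean of the
two one-sided limits. -/
structure IsBalancedBV (u : ℝ → ℂ) : Prop where
  locallyBV : LocallyBoundedVariationOn u univ
  balanced : ∀ x, u x = (Function.leftLim u x + Function.rightLim u x) / 2

/-! ### The differential equation `J u' + q u = w f` -/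

/-- The distributional derivative `u'` applied to a test function, `u'(φ) = -∫ u φ' dx`. -/
noncomputable def derivPairing (u : ℝ → ℂ) (φ : Test) : ℂ :=
  -∫ x, deriv φ x • u x

/-- The product `q u` applied to a test function, `(q u)(φ) = ∫ u φ dq`. -/
noncomputable def mulPairing (q : RealDistribution) (u : ℝ → ℂ) (φ : Test) : ℂ :=
  ∫ x, φ x • u x ∂(jordanPair q).1 - ∫ x, φ x • u x ∂(jordanPair q).2

/-- `J u' + q u = w f` in the sense of distributions, for non-negative `w`. -/
def SolvesEq (J : ℂ) (q w : RealDistribution) (u f : ℝ → ℂ) : Prop :=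
  ∀ φ : Test,
    J * derivPairing u φ + mulPairing q u φ = ∫ x, φ x • f x ∂(toMeasure w)

/-- The Hilbert space `L²(w)`, with inner product `⟪f, g⟫ = ∫ conj f * g dw`. -/
abbrev LTwo (w : RealDistribution) : Type := Lp ℂ 2 (toMeasure w)

/-! #### Facts that make the maximal relation a linear subspace -/

theorem boundedVariationOn_add {u v : ℝ → ℂ} {s : Set ℝ} (hu : BoundedVariationOn u s)
    (hv : BoundedVariationOn v s) : BoundedVariationOn (u + v) s := by
  have key : eVariationOn (u + v) s ≤ eVariationOn u s + eVariationOn v s := by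
    apply iSup_le
    rintro ⟨n, ⟨p, p_mono, p_mem⟩⟩
    calc ∑ i ∈ Finset.range n, edist ((u + v) (p (i + 1))) ((u + v) (p i))
        ≤ ∑ i ∈ Finset.range n,
            (edist (u (p (i + 1))) (u (p i)) + edist (v (p (i + 1))) (v (p i))) :=
          Finset.sum_le_sum fun i _ => edist_add_add_le _ _ _ _
      _ = ∑ i ∈ Finset.range n, edist (u (p (i + 1))) (u (p i)) +
            ∑ i ∈ Finset.range n, edist (v (p (i + 1))) (v (p i)) := Finset.sum_add_distrib
      _ ≤ eVariationOn u s + eVariationOn v s :=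
          add_le_add (eVariationOn.sum_le p_mono p_mem) (eVariationOn.sum_le p_mono p_mem)
  exact ne_top_of_le_ne_top (ENNReal.add_ne_top.2 ⟨hu, hv⟩) key

theorem IsBalancedBV.tendsto_left {u : ℝ → ℂ} (h : IsBalancedBV u) (x : ℝ) :
    Filter.Tendsto u (nhdsWithin x (Iio x)) (nhds (Function.leftLim u x)) := by
  apply tendsto_leftLim_of_tendsto
  have h1 : BoundedVariationOn u (Icc (x - 1) x) := by
    simpa using h.locallyBV (x - 1) x (mem_univ _) (mem_univ _)
  obtain ⟨l, hl⟩ := h1.exists_tendsto_left x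
  refine ⟨l, hl.mono_left (le_of_eq ?_)⟩
  apply nhdsWithin_eq_nhdsWithin (s := Ioi (x - 1)) (by simp) isOpen_Ioi
  ext y
  simp only [mem_inter_iff, mem_Iio, mem_Ioi, mem_Icc]
  constructor
  · rintro ⟨h1, h2⟩
    exact ⟨⟨⟨h2.le, h1.le⟩, h1⟩, h2⟩
  · rintro ⟨⟨_, h1⟩, h2⟩
    exact ⟨h1, h2⟩

theorem IsBalancedBV.tendsto_right {u : ℝ → ℂ} (h : IsBalancedBV u) (x : ℝ) :
    Filter.Tendsto u (nhdsWithin x (Ioi x)) (nhds (Function.rightLim u x)) := by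
  apply tendsto_rightLim_of_tendsto
  have h1 : BoundedVariationOn u (Icc x (x + 1)) := by
    simpa using h.locallyBV x (x + 1) (mem_univ _) (mem_univ _)
  obtain ⟨l, hl⟩ := h1.exists_tendsto_right x
  refine ⟨l, hl.mono_left (le_of_eq ?_)⟩
  apply nhdsWithin_eq_nhdsWithin (s := Iio (x + 1)) (by simp) isOpen_Iio
  ext y
  simp only [mem_inter_iff, mem_Iio, mem_Ioi, mem_Icc]
  constructor
  · rintro ⟨h1, h2⟩
    exact ⟨⟨⟨h1.le, h2.le⟩, h1⟩, h2⟩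
  · rintro ⟨⟨_, h1⟩, h2⟩
    exact ⟨h1, h2⟩

theorem IsBalancedBV.zero : IsBalancedBV 0 := by
  refine ⟨fun a b _ _ => ?_, fun x => ?_⟩
  · have h : eVariationOn (0 : ℝ → ℂ) (univ ∩ Icc a b) = 0 :=
      eVariationOn.constant_on (by rintro _ ⟨_, _, rfl⟩ _ ⟨_, _, rfl⟩; rfl)
    rw [BoundedVariationOn, h]
    exact ENNReal.zero_ne_top
  · have h1 : Function.leftLim (0 : ℝ → ℂ) x = 0 :=
      (continuous_zero.continuousAt (x := x)).continuousWithinAt.leftLim_eq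
    have h2 : Function.rightLim (0 : ℝ → ℂ) x = 0 :=
      (continuous_zero.continuousAt (x := x)).continuousWithinAt.rightLim_eq
    simp [h1, h2]

theorem IsBalancedBV.add {u v : ℝ → ℂ} (hu : IsBalancedBV u) (hv : IsBalancedBV v) :
    IsBalancedBV (u + v) := by
  refine ⟨fun a b ha hb => boundedVariationOn_add (hu.locallyBV a b ha hb)
    (hv.locallyBV a b ha hb), fun x => ?_⟩
  have h1 : Function.leftLim (u + v) x = Function.leftLim u x + Function.leftLim v x :=
    leftLim_eq_of_tendsto ((hu.tendsto_left x).add (hv.tendsto_left x))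
  have h2 : Function.rightLim (u + v) x = Function.rightLim u x + Function.rightLim v x :=
    rightLim_eq_of_tendsto
      ((hu.tendsto_right x).add (hv.tendsto_right x))
  rw [h1, h2, Pi.add_apply, hu.balanced x, hv.balanced x]
  ring

theorem IsBalancedBV.smul {u : ℝ → ℂ} (c : ℂ) (hu : IsBalancedBV u) :
    IsBalancedBV (c • u) := by
  refine ⟨(lipschitzWith_smul c).comp_locallyBoundedVariationOn hu.locallyBV, fun x => ?_⟩
  have h1 : Function.leftLim (c • u) x = c • Function.leftLim u x :=
    leftLim_eq_of_tendsto ((hu.tendsto_left x).const_smul c)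
  have h2 : Function.rightLim (c • u) x = c • Function.rightLim u x :=
    rightLim_eq_of_tendsto ((hu.tendsto_right x).const_smul c)
  rw [h1, h2, Pi.smul_apply, hu.balanced x]
  simp only [smul_eq_mul]
  ring

theorem IsBalancedBV.measurable {u : ℝ → ℂ} (hu : IsBalancedBV u) : Measurable u := by
  have real : ∀ g : ℝ → ℝ, LocallyBoundedVariationOn g univ → Measurable g := by
    intro g hg
    obtain ⟨p, r, hp, hr, rfl⟩ := hg.exists_monotoneOn_sub_monotoneOn
    exact (monotoneOn_univ.1 hp).measurable.sub (monotoneOn_univ.1 hr).measurable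
  have hre := real _ (Complex.reCLM.lipschitz.comp_locallyBoundedVariationOn hu.locallyBV)
  have him := real _ (Complex.imCLM.lipschitz.comp_locallyBoundedVariationOn hu.locallyBV)
  exact measurable_of_re_im hre him

theorem IsBalancedBV.locallyIntegrable {u : ℝ → ℂ} (hu : IsBalancedBV u) (μ : Measure ℝ)
    [IsLocallyFiniteMeasure μ] : LocallyIntegrable u μ := by
  intro x
  refine ⟨Icc (x - 1) (x + 1), Icc_mem_nhds (by linarith) (by linarith), ?_⟩
  have hbv : BoundedVariationOn u (Icc (x - 1) (x + 1)) := by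
    simpa using hu.locallyBV (x - 1) (x + 1) (mem_univ _) (mem_univ _)
  refine Measure.integrableOn_of_bounded
    (M := ‖u x‖ + (eVariationOn u (Icc (x - 1) (x + 1))).toReal)
    isCompact_Icc.measure_lt_top.ne hu.measurable.aestronglyMeasurable ?_
  refine (ae_restrict_mem measurableSet_Icc).mono fun y hy => ?_
  have h1 := hbv.dist_le hy (show x ∈ Icc (x - 1) (x + 1) from ⟨by linarith, by linarith⟩)
  rw [dist_eq_norm] at h1
  have h2 := norm_le_norm_add_norm_sub' (u y) (u x)
  linarith

theorem integrable_test_smul {u : ℝ → ℂ} {μ : Measure ℝ} (hu : LocallyIntegrable u μ)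
    (φ : Test) : Integrable (fun x => φ x • u x) μ :=
  hu.integrable_smul_left_of_hasCompactSupport φ.continuous φ.hasCompactSupport

theorem integrable_deriv_smul {u : ℝ → ℂ} {μ : Measure ℝ} (hu : LocallyIntegrable u μ)
    (φ : Test) : Integrable (fun x => deriv φ x • u x) μ :=
  hu.integrable_smul_left_of_hasCompactSupport
    (φ.contDiff.continuous_deriv (by simp)) φ.hasCompactSupport.deriv

theorem locallyIntegrable_LTwo {w : RealDistribution} (f : LTwo w) :
    LocallyIntegrable f (toMeasure w) :=
  (Lp.memLp f).locallyIntegrable (by norm_num)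

theorem derivPairing_add {u v : ℝ → ℂ} (hu : IsBalancedBV u) (hv : IsBalancedBV v) (φ : Test) :
    derivPairing (u + v) φ = derivPairing u φ + derivPairing v φ := by
  simp only [derivPairing, Pi.add_apply, smul_add]
  rw [integral_add (integrable_deriv_smul (hu.locallyIntegrable _) φ)
    (integrable_deriv_smul (hv.locallyIntegrable _) φ)]
  ring

theorem derivPairing_smul (c : ℂ) (u : ℝ → ℂ) (φ : Test) :
    derivPairing (c • u) φ = c * derivPairing u φ := by
  simp only [derivPairing, Pi.smul_apply, smul_comm _ c]
  rw [integral_smul, smul_eq_mul, mul_neg]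

theorem mulPairing_add (q : RealDistribution) {u v : ℝ → ℂ} (hu : IsBalancedBV u)
    (hv : IsBalancedBV v) (φ : Test) :
    mulPairing q (u + v) φ = mulPairing q u φ + mulPairing q v φ := by
  simp only [mulPairing, Pi.add_apply, smul_add]
  rw [integral_add (integrable_test_smul (hu.locallyIntegrable _) φ)
      (integrable_test_smul (hv.locallyIntegrable _) φ),
    integral_add (integrable_test_smul (hu.locallyIntegrable _) φ)
      (integrable_test_smul (hv.locallyIntegrable _) φ)]
  ring

theorem mulPairing_smul (q : RealDistribution) (c : ℂ) (u : ℝ → ℂ) (φ : Test) :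
    mulPairing q (c • u) φ = c * mulPairing q u φ := by
  simp only [mulPairing, Pi.smul_apply, smul_comm _ c]
  rw [integral_smul, integral_smul, smul_eq_mul, smul_eq_mul, mul_sub]

/-! ### The maximal relation -/

/-- The maximal relation `T_max ⊆ L²(w) × L²(w)`: all pairs `([u], [f])` of classes where `u` is a
balanced function of locally bounded variation and `J u' + q u = w f`. -/
noncomputable def Tmax (J : ℂ) (q w : RealDistribution) : Submodule ℂ (LTwo w × LTwo w) where
  carrier := {p | ∃ u : ℝ → ℂ, IsBalancedBV u ∧ (p.1 : ℝ → ℂ) =ᵐ[toMeasure w] u ∧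
    SolvesEq J q w u p.2}
  zero_mem' := by
    refine ⟨0, .zero, Lp.coeFn_zero _ _ _, fun φ => ?_⟩
    have h : ∫ x, φ x • ((0 : LTwo w) : ℝ → ℂ) x ∂(toMeasure w) = 0 := by
      rw [← integral_zero ℝ ℂ (μ := toMeasure w)]
      apply integral_congr_ae
      filter_upwards [Lp.coeFn_zero ℂ 2 (toMeasure w)] with x hx
      rw [hx, Pi.zero_apply, smul_zero]
    simpa [derivPairing, mulPairing] using h.symm
  add_mem' := by
    rintro p p' ⟨u, hu, hpu, he⟩ ⟨u', hu', hpu', he'⟩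
    refine ⟨u + u', hu.add hu', (Lp.coeFn_add _ _).trans (hpu.add hpu'), fun φ => ?_⟩
    have h : ∫ x, φ x • ((p.2 + p'.2 : LTwo w) : ℝ → ℂ) x ∂(toMeasure w) =
        ∫ x, φ x • (p.2 : ℝ → ℂ) x ∂(toMeasure w) +
          ∫ x, φ x • (p'.2 : ℝ → ℂ) x ∂(toMeasure w) := by
      rw [← integral_add (integrable_test_smul (locallyIntegrable_LTwo _) φ)
        (integrable_test_smul (locallyIntegrable_LTwo _) φ)]
      apply integral_congr_ae
      filter_upwards [Lp.coeFn_add p.2 p'.2] with x hx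
      rw [hx, Pi.add_apply, smul_add]
    rw [Prod.snd_add, h, ← he φ, ← he' φ, derivPairing_add hu hu', mulPairing_add q hu hu']
    ring
  smul_mem' := by
    rintro c p ⟨u, hu, hpu, he⟩
    refine ⟨c • u, hu.smul c, (Lp.coeFn_smul _ _).trans (hpu.const_smul c), fun φ => ?_⟩
    have h : ∫ x, φ x • ((c • p.2 : LTwo w) : ℝ → ℂ) x ∂(toMeasure w) =
        c * ∫ x, φ x • (p.2 : ℝ → ℂ) x ∂(toMeasure w) := by
      rw [← smul_eq_mul, ← integral_smul]
      apply integral_congr_ae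
      filter_upwards [Lp.coeFn_smul c p.2] with x hx
      rw [hx, Pi.smul_apply, smul_comm]
    rw [Prod.smul_snd, h, ← he φ, derivPairing_smul, mulPairing_smul]
    ring

end PeriodicSystem

/-! ### Linear relations in a Hilbert space and their spectrum -/

namespace LinearRelation

variable {H : Type*} [NormedAddCommGroup H] [InnerProductSpace ℂ H]

/-- `T` is self-adjoint if it equals its adjoint, the relation of all `(v, g)` which satisfy
`⟪f, v⟫ = ⟪u, g⟫` for all `(u, f) ∈ T`. -/
def IsSelfAdjoint (T : Submodule ℂ (H × H)) : Prop := T.adjoint = T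

/-- The relation `T - z = {(u, f - z u) : (u, f) ∈ T}`. -/
def shift (T : Submodule ℂ (H × H)) (z : ℂ) : Submodule ℂ (H × H) :=
  T.map ((LinearMap.fst ℂ H H).prod (LinearMap.snd ℂ H H - z • LinearMap.fst ℂ H H))

/-- The kernel `{u : (u, 0) ∈ T}`. -/
def ker (T : Submodule ℂ (H × H)) : Submodule ℂ H := T.comap (LinearMap.inl ℂ H H)

/-- The range `{f : (u, f) ∈ T for some u}`. -/
def ran (T : Submodule ℂ (H × H)) : Submodule ℂ H := T.map (LinearMap.snd ℂ H H)

/-- The resolvent set: `ker (T - z)` is trivial and `ran (T - z)` is the whole space. -/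
def resolventSet (T : Submodule ℂ (H × H)) : Set ℂ :=
  {z | ker (shift T z) = ⊥ ∧ ran (shift T z) = ⊤}

/-- The spectrum, the complement of the resolvent set. -/
def spectrum (T : Submodule ℂ (H × H)) : Set ℂ := (resolventSet T)ᶜ

/-- The continuous spectrum: `T - z` is injective, and its range is dense but not the whole
space. -/
def continuousSpectrum (T : Submodule ℂ (H × H)) : Set ℂ :=
  {z | ker (shift T z) = ⊥ ∧ Dense (ran (shift T z) : Set H) ∧ ran (shift T z) ≠ ⊤}

end LinearRelation

namespace PeriodicSystem

open MeasureTheory Set Function Filter Topology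
open scoped ComplexConjugate NNReal ENNReal

/-! The positive and negative parts of q and the measure of w are all dominated by their sum κ, so q
= pκ and w = rκ with bounded densities. A balanced solution u of Ju' + qu = wf is then described by
its left-continuous version U: U is a primitive of kκ with k = (rf - pu)/J, and u = U + κ{t}k/2,
which puts u halfway across each jump. `IsDensity.isSol` and `IsDensity.solvesEq` translate between
the two forms.

Two facts drive the argument. Because u is balanced and J is imaginary, the jump terms in the
product rule cancel exactly, so Lagrange's identity `IsSol.lagrange` holds in spite of atoms. Since
the system is scalar, this makes |U| constant for every homogeneous solution. Moreover 2J + pκ{t}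
never vanishes, so U and f determine u at each atom, and initial value problems are uniquely
solvable on the whole line.

Periodicity supplies two further facts. Atoms are uniformly bounded, so |U| ≤ K(|u| + |f|) and
square integrability of u and f controls U; and w has infinite mass near both ends. For real z,
replacing p by p - zr reduces Tmax - z to z = 0. A kernel element has constant |U|, which infinite
mass forces to be 0. If v is a nowhere vanishing homogeneous solution, its truncation to [a,b) is
not in the range when w charges [a,b): an L² solution would satisfy U(a) = U(b) = 0, and Lagrange's
identity would give ∫|v|² dw = 0 over [a,b).

Self-adjointness has two halves. For symmetry, the boundary form conj(U)U' converges at both ends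
and is dominated by a w-integrable function, hence tends to 0. For the inclusion of the adjoint in
Tmax, a compactly supported g orthogonal to v on its interval has a compactly supported solution;
testing with these shows that an adjoint element differs locally from a particular solution by a
multiple of v, and the multiples agree. Finally, a self-adjoint relation has every nonreal number in
its resolvent set, and a trivial kernel at real z makes the range dense. -/

/-- `U` is, on `s`, a left-continuous primitive of the measure `h κ`. -/
def IsPrim {𝕜 : Type*} [RCLike 𝕜] (κ : Measure ℝ) (s : Set ℝ) (U h : ℝ → 𝕜) : Prop :=
  ∀ a ∈ s, ∀ b ∈ s, a ≤ b → IntegrableOn h (Ico a b) κ ∧ U b - U a = ∫ t in Ico a b, h t ∂κ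

/-! ### Primitives and integration by parts for measures with atoms -/

section Product

variable {𝕜 : Type*} [RCLike 𝕜] {μ ν κ : Measure ℝ} {s : Set ℝ} {F f G g : ℝ → 𝕜}

theorem IsPrim.mono {t : Set ℝ} (h : IsPrim κ s F f) (hts : t ⊆ s) : IsPrim κ t F f :=
  fun a ha b hb => h a (hts ha) b (hts hb)

theorem IsPrim.add (hF : IsPrim κ s F f) (hG : IsPrim κ s G g) : IsPrim κ s (F + G) (f + g) := by
  intro a ha b hb hab
  obtain ⟨h1, h2⟩ := hF a ha b hb hab
  obtain ⟨h3, h4⟩ := hG a ha b hb hab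
  refine ⟨h1.add h3, ?_⟩
  simp only [Pi.add_apply]
  rw [integral_add h1 h3, ← h2, ← h4]
  ring

theorem IsPrim.const_mul (c : 𝕜) (hF : IsPrim κ s F f) :
    IsPrim κ s (fun t => c * F t) (fun t => c * f t) := by
  intro a ha b hb hab
  obtain ⟨h1, h2⟩ := hF a ha b hb hab
  refine ⟨Integrable.const_mul h1 c, ?_⟩
  rw [integral_const_mul, ← h2]
  ring

theorem IsPrim.star (hF : IsPrim κ s F f) :
    IsPrim κ s (fun t => conj (F t)) (fun t => conj (f t)) := by
  intro a ha b hb hab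
  obtain ⟨h1, h2⟩ := hF a ha b hb hab
  refine ⟨(RCLike.conjCLE (K := 𝕜)).toContinuousLinearMap.integrable_comp h1, ?_⟩
  rw [integral_conj, ← h2, map_sub]

theorem IsPrim.integral_Icc (hF : IsPrim κ s F f) {a b c : ℝ} (ha : a ∈ s) (hc : c ∈ s)
    (hab : a ≤ b) (hbc : b < c) (hb : b ∈ s) :
    ∫ t in Icc a b, f t ∂κ = F b - F a + f b * κ.real {b} := by
  rw [(hF a ha b hb hab).2, ← Ico_union_right hab, setIntegral_union (by simp) (by simp)
    (hF a ha b hb hab).1, integral_singleton, RCLike.real_smul_eq_coe_mul, mul_comm]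
  exact (hF a ha c hc (hab.trans hbc.le)).1.mono_set (by
    rintro x rfl; exact ⟨hab, hbc⟩)

/-- Integration by parts for primitives of measures which may have atoms. -/
theorem IsPrim.mul [SigmaFinite μ] [SigmaFinite ν] (hs : s.OrdConnected) (hF : IsPrim μ s F f)
    (hG : IsPrim ν s G g) {a b : ℝ} (ha : a ∈ s) (hb : b ∈ s) (hab : a ≤ b) :
    IntegrableOn (fun t => F t * g t) (Ico a b) ν ∧
    IntegrableOn (fun t => f t * (G t + g t * ν.real {t})) (Ico a b) μ ∧
    F b * G b - F a * G a = ∫ t in Ico a b, F t * g t ∂ν +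
      ∫ t in Ico a b, f t * (G t + g t * ν.real {t}) ∂μ := by
  have hsub : Icc a b ⊆ s := hs.out ha hb
  obtain ⟨hf, hfb⟩ := hF a ha b hb hab
  obtain ⟨hg, hgb⟩ := hG a ha b hb hab
  set μ' := μ.restrict (Ico a b)
  set ν' := ν.restrict (Ico a b)
  have hint : Integrable (fun z : ℝ × ℝ => f z.1 * g z.2) (μ'.prod ν') := hf.mul_prod hg
  set S : Set (ℝ × ℝ) := {z | z.1 < z.2}
  have hS : MeasurableSet S := measurableSet_lt measurable_fst measurable_snd
  have i1 := hint.indicator hS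
  have i2 := hint.indicator hS.compl
  -- Fubini on the square, cut along the diagonal. The diagonal goes entirely to the second piece,
  -- whose inner integral therefore runs over a closed interval and picks up the atom term `g t *
  -- ν.real {t}`.
  have hsplit : (∫ t, f t ∂μ') * ∫ t, g t ∂ν' =
      ∫ z, S.indicator (fun z : ℝ × ℝ => f z.1 * g z.2) z ∂(μ'.prod ν') +
      ∫ z, Sᶜ.indicator (fun z : ℝ × ℝ => f z.1 * g z.2) z ∂(μ'.prod ν') := by
    rw [← integral_add i1 i2, ← integral_prod_mul]
    congr 1
    ext z
    exact (congrFun (indicator_self_add_compl S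
      (fun z : ℝ × ℝ => f z.1 * g z.2)) z).symm
  have e1 : ∀ t ∈ Ico a b, ∫ x, S.indicator (fun z : ℝ × ℝ => f z.1 * g z.2) (x, t) ∂μ' =
      (F t - F a) * g t := by
    intro t ht
    rw [(hF a ha t (hsub ⟨ht.1, ht.2.le⟩) ht.1).2, ← integral_mul_const]
    rw [← integral_indicator measurableSet_Ico, ← integral_indicator measurableSet_Ico]
    congr 1
    ext x
    simp only [indicator, S, mem_ofPred_eq, mem_Ico]
    split_ifs with h1 h2 h3 h3 h3 <;> first | rfl | (exfalso; simp only [mem_Ico] at ht; grind)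
  have e2 : ∀ t ∈ Ico a b, ∫ x, Sᶜ.indicator (fun z : ℝ × ℝ => f z.1 * g z.2) (t, x) ∂ν' =
      f t * (G t + g t * ν.real {t} - G a) := by
    intro t ht
    have := hG.integral_Icc ha hb ht.1 ht.2 (hsub ⟨ht.1, ht.2.le⟩)
    rw [show G t + g t * ν.real {t} - G a = ∫ x in Icc a t, g x ∂ν by rw [this]; ring,
      ← integral_const_mul]
    rw [← integral_indicator measurableSet_Ico, ← integral_indicator measurableSet_Icc]
    congr 1
    ext x
    simp only [indicator, S, mem_ofPred_eq, mem_Ico, mem_Icc, mem_compl_iff]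
    split_ifs with h1 h2 h3 h3 h3 <;> first | rfl | (exfalso; simp only [mem_Ico] at ht; grind)
  have e1' : (fun t => ∫ x, S.indicator (fun z : ℝ × ℝ => f z.1 * g z.2) (x, t) ∂μ') =ᵐ[ν']
      fun t => (F t - F a) * g t :=
    (ae_restrict_mem measurableSet_Ico).mono e1
  have e2' : (fun t => ∫ x, Sᶜ.indicator (fun z : ℝ × ℝ => f z.1 * g z.2) (t, x) ∂ν') =ᵐ[μ']
      fun t => f t * (G t + g t * ν.real {t} - G a) :=
    (ae_restrict_mem measurableSet_Ico).mono e2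
  have j1 : Integrable (fun t => (F t - F a) * g t) ν' := i1.integral_prod_right.congr e1'
  have j2 : Integrable (fun t => f t * (G t + g t * ν.real {t} - G a)) μ' :=
    i2.integral_prod_left.congr e2'
  have k1 : Integrable (fun t => F t * g t) ν' := 
    (j1.add (Integrable.const_mul hg (F a))).congr
      (ae_of_all _ fun t => by simp only [Pi.add_apply]; ring)
  have k2 : Integrable (fun t => f t * (G t + g t * ν.real {t})) μ' := 
    (j2.add (Integrable.const_mul hf (G a))).congr
      (ae_of_all _ fun t => by simp only [Pi.add_apply]; ring)
  refine ⟨k1, k2, ?_⟩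
  rw [integral_prod_symm _ i1, integral_prod _ i2, integral_congr_ae e1', integral_congr_ae e2']
    at hsplit
  have l1 : ∫ t, (F t - F a) * g t ∂ν' = ∫ t, F t * g t ∂ν' - F a * ∫ t, g t ∂ν' := by
    rw [← integral_const_mul, ← integral_sub k1 (Integrable.const_mul hg (F a))]
    congr 1; ext t; ring
  have l2 : ∫ t, f t * (G t + g t * ν.real {t} - G a) ∂μ' =
      ∫ t, f t * (G t + g t * ν.real {t}) ∂μ' - G a * ∫ t, f t ∂μ' := by
    rw [← integral_const_mul, ← integral_sub k2 (Integrable.const_mul hf (G a))]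
    congr 1; ext t; ring
  rw [l1, l2, ← hfb, ← hgb] at hsplit
  linear_combination hsplit

end Product

/-! ### Powers of a distribution function -/

section Power

variable {κ : Measure ℝ} [IsLocallyFiniteMeasure κ]

theorem measure_Ico_ne_top (κ : Measure ℝ) [IsLocallyFiniteMeasure κ] (a b : ℝ) :
    κ (Ico a b) ≠ ∞ :=
  ((measure_mono Ico_subset_Icc_self).trans_lt isCompact_Icc.measure_lt_top).ne

theorem isPrim_measure (κ : Measure ℝ) [IsLocallyFiniteMeasure κ] (a : ℝ) :
    IsPrim κ (Ici a) (fun x => κ.real (Ico a x)) (fun _ => (1 : ℝ)) := by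
  intro x hx y hy hxy
  refine ⟨integrableOn_const (measure_Ico_ne_top κ _ _), ?_⟩
  have h := measureReal_union (μ := κ) (s₁ := Ico a x) (s₂ := Ico x y)
    (by simp) measurableSet_Ico (measure_Ico_ne_top κ _ _) (measure_Ico_ne_top κ _ _)
  rw [Ico_union_Ico_eq_Ico hx hxy] at h
  simp [h]

/-- For M(t) = κ[a,t), integration by parts gives d(M^(n+1)) ≥ (n+1) M^n dM, with equality when
there are no atoms: each atom only adds nonnegative terms. This is what puts n! in the denominator
of the Neumann series. -/
theorem integral_measure_pow_le (κ : Measure ℝ) [IsLocallyFiniteMeasure κ] {a x : ℝ} (hx : a ≤ x)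
    (n : ℕ) :
    IntegrableOn (fun t => κ.real (Ico a t) ^ n) (Ico a x) κ ∧
    (n + 1) * ∫ t in Ico a x, κ.real (Ico a t) ^ n ∂κ ≤ κ.real (Ico a x) ^ (n + 1) := by
  set M : ℝ → ℝ := fun x => κ.real (Ico a x)
  have hM := isPrim_measure κ a
  -- An explicit density of M^n is built by repeated use of the product rule; only its lower bound n
  -- M^(n-1) is needed.
  have key : ∀ n : ℕ, ∃ g : ℝ → ℝ, IsPrim κ (Ici a) (fun t => M t ^ n) g ∧
      ∀ t, n * M t ^ (n - 1) ≤ g t := by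
    intro n
    induction n with
    | zero => exact ⟨0, fun _ _ _ _ _ => by simp [IntegrableOn], by simp⟩
    | succ n ih =>
      obtain ⟨g, hg, hgM⟩ := ih
      refine ⟨fun t => M t * g t + 1 * (M t ^ n + g t * κ.real {t}), ?_, ?_⟩
      · intro x hx y hy hxy
        obtain ⟨h1, h2, h3⟩ := hM.mul ordConnected_Ici hg hx hy hxy
        refine ⟨h1.add h2, ?_⟩
        simp only [pow_succ']
        exact h3.trans (integral_add h1 h2).symm
      · intro t
        have hM0 : 0 ≤ M t := measureReal_nonneg
        have hg0 : 0 ≤ g t := le_trans (by positivity) (hgM t)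
        have h1 : M t * (n * M t ^ (n - 1)) ≤ M t * g t := by gcongr; exact hgM t
        have h2 : 0 ≤ g t * κ.real {t} := by positivity
        have h3 : M t * (n * M t ^ (n - 1)) = n * M t ^ n := by
          rcases n with _ | n
          · simp
          · simp only [Nat.add_sub_cancel]; ring
        simp only [Nat.add_sub_cancel]
        push_cast
        linarith
  obtain ⟨g, hg, hgM⟩ := key (n + 1)
  obtain ⟨h1, h2⟩ := hg a self_mem_Ici x hx hx
  have hint : IntegrableOn (fun t => M t ^ n) (Ico a x) κ := by
    obtain ⟨g', hg', -⟩ := key n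
    have := (hg'.mul ordConnected_Ici hM self_mem_Ici hx hx).1
    simpa using this
  refine ⟨hint, ?_⟩
  have h3 : M a = 0 := by simp [M]
  simp only [h3] at h2
  rw [zero_pow (Nat.succ_ne_zero n), sub_zero] at h2
  rw [← integral_const_mul]
  change _ ≤ M x ^ (n + 1)
  rw [h2]
  apply integral_mono (Integrable.const_mul hint _) h1
  intro t
  have := hgM t
  push_cast at this
  simpa using this

end Power

/-! ### Linear Volterra equations with respect to a measure -/

section Volterra

variable {κ : Measure ℝ}

theorem isPrim_integral {a : ℝ} {h : ℝ → ℂ} (c : ℂ)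
    (hh : ∀ x, a ≤ x → IntegrableOn h (Ico a x) κ) :
    IsPrim κ (Ici a) (fun x => c + ∫ t in Ico a x, h t ∂κ) h := by
  intro x hx y hy hxy
  have h1 : IntegrableOn h (Ico x y) κ := (hh y hy).mono_set (Ico_subset_Ico_left hx)
  refine ⟨h1, ?_⟩
  have h2 := setIntegral_union (by simp) measurableSet_Ico (hh x hx) h1
  rw [Ico_union_Ico_eq_Ico hx hxy] at h2
  simp only [h2]
  ring

/-- The iterates in the Neumann series of the linear Volterra equation. -/
noncomputable def volterraIter (κ : Measure ℝ) (a : ℝ) (c : ℂ) (β γ : ℝ → ℂ) : ℕ → ℝ → ℂ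
  | 0 => fun x => c + ∫ t in Ico a x, β t ∂κ
  | n + 1 => fun x => 0 + ∫ t in Ico a x, γ t * volterraIter κ a c β γ n t ∂κ

/-- The usual Picard estimate. Integration over [a,x) leaves out the atom at x, so the factorial
bound survives without any smallness condition on the atoms. -/
theorem volterraIter_spec [IsLocallyFiniteMeasure κ] {a : ℝ} {c : ℂ} {β γ : ℝ → ℂ} {C : ℝ}
    (hC : 0 ≤ C) (hγm : Measurable γ) (hγ : ∀ t, ‖γ t‖ ≤ C)
    (hβ : ∀ x, a ≤ x → IntegrableOn β (Ico a x) κ) (n : ℕ) :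
    (∀ x, a ≤ x → IntegrableOn (fun t => γ t * volterraIter κ a c β γ n t) (Ico a x) κ) ∧
    ∀ x, a ≤ x → ‖volterraIter κ a c β γ n x‖ ≤
      (‖c‖ + ∫ t in Ico a x, ‖β t‖ ∂κ) * ((C * κ.real (Ico a x)) ^ n / n.factorial) := by
  have hγi : ∀ x, a ≤ x → IntegrableOn γ (Ico a x) κ := fun x _ =>
    Measure.integrableOn_of_bounded (measure_Ico_ne_top κ _ _) hγm.aestronglyMeasurable
      (ae_of_all _ hγ)
  -- Every iterate is a constant plus an integral, so one statement serves both cases of the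
  -- induction. Integrability of γ times such a primitive is the first conclusion of integration by
  -- parts.
  have step : ∀ (c' : ℂ) (h : ℝ → ℂ), (∀ x, a ≤ x → IntegrableOn h (Ico a x) κ) →
      ∀ x, a ≤ x → IntegrableOn (fun t => γ t * (c' + ∫ t in Ico a t, h t ∂κ)) (Ico a x) κ := by
    intro c' h hh x hx
    have := ((isPrim_integral c' hh).mul ordConnected_Ici (isPrim_integral 0 hγi)
      self_mem_Ici hx hx).1
    simpa only [mul_comm] using this
  induction n with
  | zero =>
    refine ⟨step _ _ hβ, fun x hx => ?_⟩
    simp only [volterraIter, pow_zero, Nat.factorial_zero, Nat.cast_one, div_one, mul_one]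
    exact (norm_add_le _ _).trans (by gcongr; exact norm_integral_le_integral_norm _)
  | succ n ih =>
    refine ⟨step _ _ ih.1, fun x hx => ?_⟩
    set B : ℝ → ℝ := fun x => ‖c‖ + ∫ t in Ico a x, ‖β t‖ ∂κ
    have hB0 : ∀ t, 0 ≤ B t := fun t =>
      add_nonneg (norm_nonneg _) (integral_nonneg fun _ => norm_nonneg _)
    obtain ⟨hpi, hp⟩ := integral_measure_pow_le κ hx n
    simp only [volterraIter, zero_add]
    calc ‖∫ t in Ico a x, γ t * volterraIter κ a c β γ n t ∂κ‖
        ≤ ∫ t in Ico a x, (C * B x * C ^ n / n.factorial) * κ.real (Ico a t) ^ n ∂κ := by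
          apply norm_integral_le_of_norm_le (Integrable.const_mul hpi _)
          refine (ae_restrict_mem measurableSet_Ico).mono fun t ht => ?_
          rw [norm_mul]
          have hBt : B t ≤ B x := by
            exact add_le_add_right (setIntegral_mono_set (hβ x hx).norm
              (ae_of_all _ fun _ => norm_nonneg _)
              (Ico_subset_Ico_right ht.2.le).eventuallyLE) _
          calc ‖γ t‖ * ‖volterraIter κ a c β γ n t‖
              ≤ C * (B t * ((C * κ.real (Ico a t)) ^ n / n.factorial)) := by
                gcongr
                · exact hγ t
                · exact ih.2 t ht.1
            _ ≤ C * (B x * ((C * κ.real (Ico a t)) ^ n / n.factorial)) := by gcongr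
            _ = _ := by rw [mul_pow]; ring
      _ = (C * B x * C ^ n / n.factorial) * ∫ t in Ico a x, κ.real (Ico a t) ^ n ∂κ :=
          integral_const_mul _ _
      _ ≤ (C * B x * C ^ n / n.factorial) * (κ.real (Ico a x) ^ (n + 1) / (n + 1)) := by
          have := hB0 x
          gcongr
          rw [le_div_iff₀ (by positivity), mul_comm]
          exact hp
      _ = B x * ((C * κ.real (Ico a x)) ^ (n + 1) / (n + 1).factorial) := by
          rw [Nat.factorial_succ, mul_pow]
          push_cast
          field_simp
          ring

/-- Linear Volterra equations `dU = (β + γ U) dκ` have a solution with prescribed initial value. -/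
theorem exists_volterra [IsLocallyFiniteMeasure κ] {a : ℝ} (c : ℂ) {β γ : ℝ → ℂ} {C : ℝ}
    (hγm : Measurable γ) (hγ : ∀ t, ‖γ t‖ ≤ C)
    (hβ : ∀ x, a ≤ x → IntegrableOn β (Ico a x) κ) :
    ∃ U : ℝ → ℂ, IsPrim κ (Ici a) U (fun t => β t + γ t * U t) ∧ U a = c := by
  have hC : 0 ≤ C := (norm_nonneg _).trans (hγ 0)
  have spec := volterraIter_spec (c := c) hC hγm hγ hβ
  set y := volterraIter κ a c β γ
  set B : ℝ → ℝ := fun x => ‖c‖ + ∫ t in Ico a x, ‖β t‖ ∂κ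
  have hB0 : ∀ t, 0 ≤ B t := fun t =>
    add_nonneg (norm_nonneg _) (integral_nonneg fun _ => norm_nonneg _)
  have hBm : ∀ t x, a ≤ t → t ≤ x → B t ≤ B x := by
    intro t x ht htx
    exact add_le_add_right (setIntegral_mono_set (hβ x (ht.trans htx)).norm
      (ae_of_all _ fun _ => norm_nonneg _) (Ico_subset_Ico_right htx).eventuallyLE) _
  have bound : ∀ n t x, a ≤ t → t ≤ x →
      ‖y n t‖ ≤ B x * ((C * κ.real (Ico a x)) ^ n / n.factorial) := by
    intro n t x ht htx
    refine ((spec n).2 t ht).trans ?_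
    have h1 := hBm t x ht htx
    have h2 : κ.real (Ico a t) ≤ κ.real (Ico a x) :=
      measureReal_mono (Ico_subset_Ico_right htx) (measure_Ico_ne_top κ _ _)
    have := hB0 x
    change B t * _ ≤ _
    gcongr
  have hsb : ∀ x, Summable fun n : ℕ => B x * ((C * κ.real (Ico a x)) ^ n / n.factorial) :=
    fun x => (Real.summable_pow_div_factorial _).mul_left _
  have hsum : ∀ t, a ≤ t → Summable fun n => y n t := fun t ht =>
    Summable.of_norm_bounded (hsb t) fun n => bound n t t ht le_rfl
  set U : ℝ → ℂ := fun t => ∑' n, y n t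
  have hint : ∀ x, a ≤ x → HasSum (fun n => ∫ t in Ico a x, γ t * y n t ∂κ)
      (∫ t in Ico a x, γ t * U t ∂κ) ∧ IntegrableOn (fun t => γ t * U t) (Ico a x) κ := by
    intro x hx
    have hb : ∀ n, ∀ᵐ t ∂κ.restrict (Ico a x), ‖γ t * y n t‖ ≤
        C * (B x * ((C * κ.real (Ico a x)) ^ n / n.factorial)) := by
      intro n
      refine (ae_restrict_mem measurableSet_Ico).mono fun t ht => ?_
      rw [norm_mul]
      gcongr
      · exact hγ t
      · exact bound n t x ht.1 ht.2.le
    have hsm : ∀ᵐ t ∂κ.restrict (Ico a x), HasSum (fun n => γ t * y n t) (γ t * U t) :=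
      (ae_restrict_mem measurableSet_Ico).mono fun t ht => (hsum t ht.1).hasSum.mul_left _
    refine ⟨hasSum_integral_of_dominated_convergence
      (fun n _ => C * (B x * ((C * κ.real (Ico a x)) ^ n / n.factorial)))
      (fun n => ((spec n).1 x hx).aestronglyMeasurable) hb
      (ae_of_all _ fun _ => (hsb x).mul_left _)
      (integrableOn_const (measure_Ico_ne_top κ _ _)) hsm, ?_⟩
    -- U is known only as a pointwise limit: measurability of γU comes from the partial sums, its
    -- bound from the summed majorants.
    have : IsFiniteMeasure (κ.restrict (Ico a x)) :=
      isFiniteMeasure_restrict.2 (measure_Ico_ne_top κ _ _)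
    refine Integrable.of_bound (C := ∑' n : ℕ, C * (B x *
      ((C * κ.real (Ico a x)) ^ n / n.factorial))) ?_ ?_
    · exact aestronglyMeasurable_of_tendsto_ae atTop (f := fun (N : ℕ) t =>
          ∑ n ∈ Finset.range N, γ t * y n t)
        (fun N => Finset.aestronglyMeasurable_fun_sum _
          fun n _ => ((spec n).1 x hx).aestronglyMeasurable)
        (hsm.mono fun t ht => ht.tendsto_sum_nat)
    · filter_upwards [hsm, ae_all_iff.2 hb] with t h1 h2
      rw [← h1.tsum_eq]
      exact tsum_of_norm_bounded ((hsb x).mul_left C).hasSum h2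
  have hUeq : ∀ x, a ≤ x → U x = c + ∫ t in Ico a x, (β t + γ t * U t) ∂κ := by
    intro x hx
    rw [integral_add (hβ x hx) (hint x hx).2, ← (hint x hx).1.tsum_eq]
    simp only [U]
    rw [(hsum x hx).tsum_eq_zero_add, ← add_assoc]
    simp [y, volterraIter]
  have hprim := isPrim_integral (κ := κ) c fun x hx => (hβ x hx).add (hint x hx).2
  refine ⟨U, fun x hx z hz hxz => ⟨(hprim x hx z hz hxz).1, ?_⟩, by simp [hUeq a le_rfl]⟩
  rw [hUeq x hx, hUeq z hz]
  exact (hprim x hx z hz hxz).2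

end Volterra

end PeriodicSystem

/-! ### Solutions of the integral equation: Lagrange's identity, uniqueness, existence -/

namespace PeriodicSystem

open MeasureTheory Set Function Filter Topology
open scoped ComplexConjugate NNReal ENNReal

/-- `u` is, on `s`, a balanced solution of `J u' + p κ u = r κ f` with left-continuous
version `U`. -/
structure IsSol (κ : Measure ℝ) (J : ℂ) (p r : ℝ → ℝ) (s : Set ℝ) (U u f : ℝ → ℂ) : Prop where
  isPrim : IsPrim κ s U (fun t => (r t * f t - p t * u t) / J)
  eq : ∀ t ∈ s, u t = U t + κ.real {t} * ((r t * f t - p t * u t) / J) / 2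

variable {κ : Measure ℝ} {J : ℂ} {p r : ℝ → ℝ} {s : Set ℝ} {U u f U' u' f' V v : ℝ → ℂ}

theorem IsSol.mono {t : Set ℝ} (h : IsSol κ J p r s U u f) (hts : t ⊆ s) :
    IsSol κ J p r t U u f :=
  ⟨h.isPrim.mono hts, fun x hx => h.eq x (hts hx)⟩

theorem IsSol.add (h : IsSol κ J p r s U u f) (h' : IsSol κ J p r s U' u' f') :
    IsSol κ J p r s (U + U') (u + u') (f + f') := by
  refine ⟨?_, fun t ht => ?_⟩
  · convert h.isPrim.add h'.isPrim using 1
    ext t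
    simp only [Pi.add_apply]
    ring
  · simp only [Pi.add_apply]
    linear_combination h.eq t ht + h'.eq t ht

theorem IsSol.const_mul (c : ℂ) (h : IsSol κ J p r s U u f) :
    IsSol κ J p r s (fun t => c * U t) (fun t => c * u t) (fun t => c * f t) := by
  refine ⟨?_, fun t ht => ?_⟩
  · convert h.isPrim.const_mul c using 1
    ext t
    ring
  · linear_combination c * h.eq t ht

/-- A real spectral parameter can be absorbed into the real coefficient p, so statements about Tmax
- z follow from the case z = 0. -/
theorem IsSol.shift (h : IsSol κ J p r s U u f) (z : ℝ) :
    IsSol κ J (fun t => p t - z * r t) r s U u (fun t => f t - z * u t) := by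
  have e : ∀ t, (r t : ℂ) * (f t - z * u t) - ((p t - z * r t : ℝ) : ℂ) * u t =
      r t * f t - p t * u t := fun t => by push_cast; ring
  exact ⟨by simpa only [e] using h.isPrim, fun t ht => by rw [e]; exact h.eq t ht⟩

theorem conj_eq_neg_of_re (hJ : J.re = 0) : conj J = -J := by
  apply Complex.ext <;> simp [hJ]

/-- Lagrange's identity. -/
theorem IsSol.lagrange [SigmaFinite κ] (hs : s.OrdConnected) (hJ0 : J ≠ 0) (hJ : J.re = 0)
    (h : IsSol κ J p r s U u f) (h' : IsSol κ J p r s U' u' f') {a b : ℝ}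
    (ha : a ∈ s) (hb : b ∈ s) (hab : a ≤ b) :
    J * (conj (U b) * U' b - conj (U a) * U' a) =
      ∫ t in Ico a b, r t * (conj (u t) * f' t - conj (f t) * u' t) ∂κ := by
  obtain ⟨h1, h2, h3⟩ := h.isPrim.star.mul hs h'.isPrim ha hb hab
  rw [h3, ← integral_add h1 h2, ← integral_const_mul]
  -- With k and k' the densities of U and U', the product rule yields conj(U)k' + conj(k)(U' +
  -- k'κ{t}). Inserting U = u - kκ{t}/2 and U' = u' - k'κ{t}/2 cancels all atom terms; multiplying
  -- by J and using conj J = -J then cancels the p-terms.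
  refine setIntegral_congr_fun measurableSet_Ico fun t ht => ?_
  have hts : t ∈ s := hs.out ha hb ⟨ht.1, ht.2.le⟩
  have e1 := congrArg conj (h.eq t hts)
  have e2 := h'.eq t hts
  simp only [map_add, map_mul, map_div₀, map_sub, Complex.conj_ofReal, conj_eq_neg_of_re hJ,
    map_ofNat] at e1 ⊢
  have e1' : conj (U t) = conj (u t) +
      κ.real {t} * ((r t * conj (f t) - p t * conj (u t)) / J) / 2 := by
    rw [div_neg] at e1
    linear_combination -e1
  have e2' : U' t = u' t - κ.real {t} * ((r t * f' t - p t * u' t) / J) / 2 := by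
    linear_combination -e2
  rw [e1', e2']
  simp only [RCLike.ofReal_eq_complex_ofReal]
  field_simp
  ring

/-- Lagrange's identity of a homogeneous solution with itself: its right-hand side is zero and its
left-hand side is J(|V(b)|² - |V(a)|²). -/
theorem IsSol.norm_eq [SigmaFinite κ] (hs : s.OrdConnected) (hJ0 : J ≠ 0) (hJ : J.re = 0)
    (h : IsSol κ J p r s V v 0) {a b : ℝ} (ha : a ∈ s) (hb : b ∈ s) : ‖V a‖ = ‖V b‖ := by
  wlog hab : a ≤ b generalizing a b
  · exact (this hb ha (le_of_not_ge hab)).symm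
  have := h.lagrange hs hJ0 hJ h ha hb hab
  simp only [Pi.zero_apply, mul_zero, map_zero, zero_mul, sub_zero, integral_zero,
    mul_eq_zero, hJ0, false_or, Complex.conj_mul'] at this
  rw [sub_eq_zero] at this
  norm_cast at this
  exact ((sq_eq_sq₀ (norm_nonneg _) (norm_nonneg _)).1 this).symm

theorem two_mul_add_ne_zero (hJ0 : J ≠ 0) (hJ : J.re = 0) (x : ℝ) : 2 * J + x ≠ 0 := by
  intro h
  have := congrArg Complex.im h
  simp at this
  exact hJ0 (Complex.ext hJ this)

theorem norm_le_norm_two_mul_add (hJ : J.re = 0) (x : ℝ) : 2 * ‖J‖ ≤ ‖2 * J + x‖ := by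
  have h1 : ‖J‖ = |J.im| := by
    rw [Complex.norm_eq_sqrt_sq_add_sq, hJ]; simp [Real.sqrt_sq_eq_abs]
  have h2 := Complex.abs_im_le_norm (2 * J + x)
  simp only [Complex.add_im, Complex.mul_im, Complex.re_ofNat, Complex.im_ofNat, zero_mul,
    add_zero, Complex.ofReal_im, abs_mul] at h2
  rw [h1]
  simpa using h2

/-- The relation u = U + κ{t}(rf - pu)/(2J) solved for u. For imaginary J the coefficient of u never
vanishes, so u is determined by U and f at every atom, however large. -/
theorem IsSol.eq_left (h : IsSol κ J p r s U u f) (hJ0 : J ≠ 0) {t : ℝ} (ht : t ∈ s) :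
    (2 * J + ((p t * κ.real {t} : ℝ) : ℂ)) * u t =
      2 * J * U t + ((r t * κ.real {t} : ℝ) : ℂ) * f t := by
  have := h.eq t ht
  field_simp at this
  push_cast
  linear_combination this

theorem IsSol.eq_of_eq [SigmaFinite κ] (hs : s.OrdConnected) (hJ0 : J ≠ 0) (hJ : J.re = 0)
    (h : IsSol κ J p r s U u f) (h' : IsSol κ J p r s U' u' f) {a b : ℝ} (ha : a ∈ s)
    (hb : b ∈ s) (hU : U a = U' a) : U b = U' b ∧ u b = u' b := by
  have hd := h.add (h'.const_mul (-1))
  have hf : (f + fun t => -1 * f t) = 0 := by ext t; simp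
  rw [hf] at hd
  have h1 := hd.norm_eq hs hJ0 hJ ha hb
  simp only [Pi.add_apply, hU, neg_one_mul, add_neg_cancel, norm_zero] at h1
  have h2 : U b = U' b := by rw [← sub_eq_zero, sub_eq_add_neg]; exact norm_eq_zero.1 h1.symm
  refine ⟨h2, ?_⟩
  have e1 := h.eq_left hJ0 hb
  have e2 := h'.eq_left hJ0 hb
  rw [h2, ← e2] at e1
  exact mul_left_cancel₀ (two_mul_add_ne_zero hJ0 hJ _) e1

theorem measurable_measureReal_singleton (κ : Measure ℝ) [SFinite κ] :
    Measurable fun x => κ.real {x} := by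
  have h := measurable_measure_prodMk_left (ν := κ) (s := diagonal ℝ) measurableSet_diagonal
  have e : ∀ x : ℝ, Prod.mk x ⁻¹' diagonal ℝ = {x} := fun x => by
    ext y; simp [eq_comm]
  simp only [e] at h
  exact h.ennreal_toReal

/-- Eliminating u through the pointwise relation with U leaves a linear Volterra equation for U
alone. Its coefficients are bounded because |2/(2J + x)| ≤ 1/|J| for real x. -/
theorem exists_isSol_Ici [IsLocallyFiniteMeasure κ] (hJ0 : J ≠ 0) (hJ : J.re = 0)
    (hpm : Measurable p) {P : ℝ} (hp : ∀ t, |p t| ≤ P) {a : ℝ} (c : ℂ)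
    (hf : ∀ x, a ≤ x → IntegrableOn (fun t => (r t : ℂ) * f t) (Ico a x) κ) :
    ∃ U u, IsSol κ J p r (Ici a) U u f ∧ U a = c := by
  set D : ℝ → ℂ := fun t => 2 * J + ((p t * κ.real {t} : ℝ) : ℂ)
  have hD0 : ∀ t, D t ≠ 0 := fun t => two_mul_add_ne_zero hJ0 hJ _
  have hDm : Measurable D := (Complex.measurable_ofReal.comp
    (hpm.mul (measurable_measureReal_singleton κ))).const_add _
  have hJn : 0 < ‖J‖ := norm_pos_iff.2 hJ0
  have hDn : ∀ t, ‖2 / D t‖ ≤ ‖J‖⁻¹ := by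
    intro t
    rw [norm_div, div_le_iff₀ (norm_pos_iff.2 (hD0 t)), RCLike.norm_ofNat, inv_mul_eq_div,
      le_div_iff₀ hJn]
    exact norm_le_norm_two_mul_add hJ _
  have hγ : ∀ t, ‖-(2 / D t) * p t‖ ≤ ‖J‖⁻¹ * P := by
    intro t
    rw [norm_mul, norm_neg, Complex.norm_real, Real.norm_eq_abs]
    gcongr
    · exact hDn t
    · exact hp t
  obtain ⟨U, hU, hUa⟩ := exists_volterra (κ := κ) (a := a) c
    (β := fun t => 2 / D t * (r t * f t)) (γ := fun t => -(2 / D t) * p t)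
    (by fun_prop) hγ fun x hx => by
      refine (hf x hx).bdd_mul (c := ‖J‖⁻¹) (hDm.const_div _).aestronglyMeasurable
        (ae_of_all _ hDn)
  refine ⟨U, fun t => (2 * J * U t + ((r t * κ.real {t} : ℝ) : ℂ) * f t) / D t, ⟨?_, ?_⟩, hUa⟩
  · convert hU using 1
    ext t
    have := hD0 t
    field_simp
    simp only [D]
    push_cast
    ring
  · intro t _
    have := hD0 t
    field_simp
    simp only [D]
    push_cast
    ring

/-- The Volterra equation is only ever solved to the right, from the points -n. A multiple of a
homogeneous solution, nonzero at 0 since its modulus is constant, corrects the value at 0;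
uniqueness makes the solutions agree where they overlap. -/
theorem exists_isSol [IsLocallyFiniteMeasure κ] (hJ0 : J ≠ 0) (hJ : J.re = 0)
    (hpm : Measurable p) {P : ℝ} (hp : ∀ t, |p t| ≤ P) (c : ℂ)
    (hf : ∀ a b, IntegrableOn (fun t => (r t : ℂ) * f t) (Ico a b) κ) :
    ∃ U u, IsSol κ J p r univ U u f ∧ U 0 = c := by
  have key : ∀ n : ℕ, ∃ U u, IsSol κ J p r (Ici (-n : ℝ)) U u f ∧ U 0 = c := by
    intro n
    obtain ⟨F, φ, hF, -⟩ := exists_isSol_Ici hJ0 hJ hpm hp (a := -n) 0 fun x _ => hf _ x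
    obtain ⟨V, v, hV, hVn⟩ := exists_isSol_Ici (κ := κ) (r := r) (f := 0) hJ0 hJ hpm hp
      (a := -n) 1 fun x _ => by simp [IntegrableOn]
    have h0 : (0 : ℝ) ∈ Ici (-n : ℝ) := by simp
    have hV0 : V 0 ≠ 0 := by
      have := hV.norm_eq ordConnected_Ici hJ0 hJ self_mem_Ici h0
      rw [hVn, norm_one] at this
      exact norm_pos_iff.1 (this ▸ one_pos)
    have hs := hF.add (hV.const_mul ((c - F 0) / V 0))
    have hf0 : (f + fun t => (c - F 0) / V 0 * (0 : ℝ → ℂ) t) = f := by ext t; simp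
    rw [hf0] at hs
    refine ⟨_, _, hs, ?_⟩
    simp only [Pi.add_apply]
    field_simp
    ring
  choose Un un hn h0 using key
  have mono : ∀ n k : ℕ, n ≤ k → ∀ x : ℝ, -n ≤ x → Un n x = Un k x ∧ un n x = un k x := by
    intro n k hnk x hx
    have hnk' : (n : ℝ) ≤ k := by exact_mod_cast hnk
    have hk := (hn k).mono (t := Ici (-n : ℝ)) (Ici_subset_Ici.2 (by linarith))
    exact (hn n).eq_of_eq ordConnected_Ici hJ0 hJ hk (a := 0) (by simp) hx (by rw [h0, h0])
  have eq : ∀ n : ℕ, ∀ x : ℝ, -n ≤ x →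
      Un ⌈|x|⌉₊ x = Un n x ∧ un ⌈|x|⌉₊ x = un n x := by
    intro n x hx
    have hx' : -(⌈|x|⌉₊ : ℝ) ≤ x := by
      have := Nat.le_ceil |x|
      have := neg_abs_le x
      linarith
    rcases le_total ⌈|x|⌉₊ n with h | h
    · exact mono _ _ h x hx'
    · exact ⟨(mono _ _ h x hx).1.symm, (mono _ _ h x hx).2.symm⟩
  -- The index ⌈|x|⌉ guarantees that x lies in the half-line [-n, ∞) where the chosen solution
  -- lives.
  refine ⟨fun x => Un ⌈|x|⌉₊ x, fun x => un ⌈|x|⌉₊ x, ⟨?_, ?_⟩, h0 _⟩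
  · intro a _ b _ hab
    have ha : -(⌈|a|⌉₊ : ℝ) ≤ a := by
      have := Nat.le_ceil |a|
      have := neg_abs_le a
      linarith
    obtain ⟨h1, h2⟩ := (hn ⌈|a|⌉₊).isPrim a ha b (ha.trans hab) hab
    have hc : EqOn (fun t => ((r t : ℂ) * f t - p t * un ⌈|a|⌉₊ t) / J)
        (fun t => ((r t : ℂ) * f t - p t * un ⌈|t|⌉₊ t) / J) (Ico a b) := fun t ht => by
      simp only [(eq ⌈|a|⌉₊ t (ha.trans ht.1)).2]
    refine ⟨h1.congr_fun hc measurableSet_Ico, ?_⟩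
    rw [← setIntegral_congr_fun measurableSet_Ico hc, ← h2]
    simp only [(eq ⌈|a|⌉₊ b (ha.trans hab)).1]
  · intro t _
    have ht : -(⌈|t|⌉₊ : ℝ) ≤ t := by
      have := Nat.le_ceil |t|
      have := neg_abs_le t
      linarith
    exact (hn ⌈|t|⌉₊).eq t ht

end PeriodicSystem

namespace PeriodicSystem

open MeasureTheory Set Function Filter Topology
open scoped ComplexConjugate NNReal ENNReal

/-! ### From primitives to balanced functions and distributional derivatives -/

section Limits

variable {κ : Measure ℝ} {U k : ℝ → ℂ}

theorem tendsto_setIntegral_of_eventually_mem_iff {ι : Type*} {l : Filter ι}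
    [l.IsCountablyGenerated] {A : ι → Set ℝ} {B K : Set ℝ} (hA : ∀ i, MeasurableSet (A i))
    (hB : MeasurableSet B) (hK : MeasurableSet K) (hk : IntegrableOn k K κ)
    (hAK : ∀ᶠ i in l, A i ⊆ K) (hAB : ∀ t, ∀ᶠ i in l, t ∈ A i ↔ t ∈ B) :
    Tendsto (fun i => ∫ t in A i, k t ∂κ) l (𝓝 (∫ t in B, k t ∂κ)) := by
  rcases l.eq_or_neBot with rfl | hl
  · exact tendsto_bot
  simp only [← integral_indicator (hA _), ← integral_indicator hB]
  have hBK : B ⊆ K := by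
    intro t ht
    obtain ⟨i, h1, h2⟩ := (hAK.and (hAB t)).exists
    exact h1 (h2.2 ht)
  have e : ∀ s ⊆ K, s.indicator k = s.indicator (K.indicator k) := fun s hs => by
    rw [indicator_indicator, inter_eq_left.2 hs]
  have hki : Integrable (K.indicator k) κ := (integrable_indicator_iff hK).2 hk
  apply tendsto_integral_filter_of_dominated_convergence (fun t => ‖K.indicator k t‖)
  · filter_upwards [hAK] with i hi
    rw [e _ hi]
    exact (hki.indicator (hA i)).aestronglyMeasurable
  · filter_upwards [hAK] with i hi
    refine ae_of_all _ fun t => ?_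
    rw [e _ hi]
    exact norm_indicator_le_norm_self _ _
  · exact hki.norm
  · refine ae_of_all _ fun t => tendsto_const_nhds.congr' ?_
    filter_upwards [hAB t] with i hi
    by_cases ht : t ∈ B
    · simp [ht, hi.2 ht]
    · simp [ht, hi]

theorem IsPrim.eq_add_Ico (h : IsPrim κ univ U k) {a x : ℝ} (hx : a ≤ x) :
    U x = U a + ∫ t in Ico a x, k t ∂κ := by
  rw [← (h a trivial x trivial hx).2]; ring

theorem IsPrim.eq_add_Icc (h : IsPrim κ univ U k) {a x : ℝ} (hx : a ≤ x) :
    U x + k x * κ.real {x} = U a + ∫ t in Icc a x, k t ∂κ := by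
  rw [h.integral_Icc (c := x + 1) trivial trivial hx (by linarith) trivial]
  simp only [RCLike.ofReal_eq_complex_ofReal]
  ring

theorem IsPrim.integrableOn (h : IsPrim κ univ U k) (a b : ℝ) : IntegrableOn k (Icc a b) κ := by
  rcases le_or_gt a b with hab | hab
  · exact (h a trivial (b + 1) trivial (by linarith)).1.mono_set
      fun x hx => ⟨hx.1, by linarith [hx.2]⟩
  · simp [hab]

/-- U integrates over [a,y) and U + kκ{y} over [a,y]. As y increases to x both sets fill [a,x), so
the two versions have the same limit. -/
theorem IsPrim.tendsto_left (h : IsPrim κ univ U k) (x : ℝ) :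
    Tendsto U (𝓝[<] x) (𝓝 (U x)) ∧
    Tendsto (fun y => U y + k y * κ.real {y}) (𝓝[<] x) (𝓝 (U x)) := by
  have hev : ∀ᶠ y in 𝓝[<] x, x - 1 ≤ y ∧ y < x := by
    filter_upwards [Ioo_mem_nhdsLT (show x - 1 < x by linarith)] with y hy using ⟨hy.1.le, hy.2⟩
  have hlt : ∀ t < x, ∀ᶠ y in 𝓝[<] x, t < y := fun t ht => by
    filter_upwards [Ioo_mem_nhdsLT ht] with y hy using hy.1
  have hK := h.integrableOn (x - 1) x
  constructor
  · rw [h.eq_add_Ico (show x - 1 ≤ x by linarith)]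
    have := tendsto_setIntegral_of_eventually_mem_iff (l := 𝓝[<] x) (A := fun y => Ico (x - 1) y)
      (B := Ico (x - 1) x) (fun _ => measurableSet_Ico) measurableSet_Ico measurableSet_Icc hK
      (hev.mono fun y hy t ht => ⟨ht.1, ht.2.le.trans hy.2.le⟩) fun t => by
        rcases lt_or_ge t x with ht | ht
        · filter_upwards [hlt t ht] with y hy
          simp [ht, hy]
        · filter_upwards [hev] with y hy
          simp [ht.not_gt, (hy.2.le.trans ht).not_gt]
    refine (this.const_add (U (x - 1))).congr' ?_
    filter_upwards [hev] with y hy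
    rw [h.eq_add_Ico hy.1]
  · rw [h.eq_add_Ico (show x - 1 ≤ x by linarith)]
    have := tendsto_setIntegral_of_eventually_mem_iff (l := 𝓝[<] x) (A := fun y => Icc (x - 1) y)
      (B := Ico (x - 1) x) (fun _ => measurableSet_Icc) measurableSet_Ico measurableSet_Icc hK
      (hev.mono fun y hy t ht => ⟨ht.1, ht.2.trans hy.2.le⟩) fun t => by
        rcases lt_or_ge t x with ht | ht
        · filter_upwards [hlt t ht] with y hy
          simp [ht, hy.le]
        · filter_upwards [hev] with y hy
          simp [ht.not_gt, (hy.2.trans_le ht).not_ge]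
    refine (this.const_add (U (x - 1))).congr' ?_
    filter_upwards [hev] with y hy
    rw [h.eq_add_Icc hy.1]

theorem IsPrim.tendsto_right (h : IsPrim κ univ U k) (x : ℝ) :
    Tendsto U (𝓝[>] x) (𝓝 (U x + k x * κ.real {x})) ∧
    Tendsto (fun y => U y + k y * κ.real {y}) (𝓝[>] x) (𝓝 (U x + k x * κ.real {x})) := by
  have hev : ∀ᶠ y in 𝓝[>] x, x < y ∧ y ≤ x + 1 := by
    filter_upwards [Ioo_mem_nhdsGT (show x < x + 1 by linarith)] with y hy using ⟨hy.1, hy.2.le⟩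
  have hlt : ∀ t, x < t → ∀ᶠ y in 𝓝[>] x, y < t := fun t ht => by
    filter_upwards [Ioo_mem_nhdsGT ht] with y hy using hy.2
  have hK := h.integrableOn x (x + 1)
  constructor
  · rw [h.eq_add_Icc le_rfl]
    have := tendsto_setIntegral_of_eventually_mem_iff (l := 𝓝[>] x) (A := fun y => Ico x y)
      (B := Icc x x) (fun _ => measurableSet_Ico) measurableSet_Icc measurableSet_Icc hK
      (hev.mono fun y hy t ht => ⟨ht.1, ht.2.le.trans hy.2⟩) fun t => by
        rcases lt_or_ge x t with ht | ht
        · filter_upwards [hlt t ht] with y hy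
          simp only [mem_Ico, mem_Icc]
          constructor <;> rintro ⟨h1, h2⟩ <;> constructor <;> linarith
        · filter_upwards [hev] with y hy
          simp only [mem_Ico, mem_Icc]
          constructor <;> rintro ⟨h1, h2⟩ <;> constructor <;> linarith [hy.1]
    refine (this.const_add (U x)).congr' ?_
    filter_upwards [hev] with y hy
    rw [h.eq_add_Ico hy.1.le]
  · rw [h.eq_add_Icc le_rfl]
    have := tendsto_setIntegral_of_eventually_mem_iff (l := 𝓝[>] x) (A := fun y => Icc x y)
      (B := Icc x x) (fun _ => measurableSet_Icc) measurableSet_Icc measurableSet_Icc hK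
      (hev.mono fun y hy t ht => ⟨ht.1, ht.2.trans hy.2⟩) fun t => by
        rcases lt_or_ge x t with ht | ht
        · filter_upwards [hlt t ht] with y hy
          simp only [mem_Icc]
          constructor <;> rintro ⟨h1, h2⟩ <;> constructor <;> linarith
        · filter_upwards [hev] with y hy
          simp only [mem_Icc]
          constructor <;> rintro ⟨h1, h2⟩ <;> constructor <;> linarith [hy.1]
    refine (this.const_add (U x)).congr' ?_
    filter_upwards [hev] with y hy
    rw [h.eq_add_Icc hy.1.le]

theorem boundedVariationOn_of_dist_le {F : ℝ → ℂ} {N : ℝ → ℝ} {a b : ℝ}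
    (h : ∀ x y, a ≤ x → x ≤ y → y ≤ b → dist (F y) (F x) ≤ N y - N x) :
    BoundedVariationOn F (Icc a b) := by
  have hN : MonotoneOn N (Icc a b) := fun x hx y hy hxy =>
    sub_nonneg.1 (dist_nonneg.trans (h x y hx.1 hxy hy.2))
  have hle : eVariationOn F (Icc a b) ≤ eVariationOn N (Icc a b) := by
    apply iSup_le
    rintro ⟨n, ⟨p, p_mono, p_mem⟩⟩
    refine le_trans (Finset.sum_le_sum fun i _ => ?_) (eVariationOn.sum_le p_mono p_mem)
    rw [edist_dist, edist_dist]
    apply ENNReal.ofReal_le_ofReal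
    rw [Real.dist_eq]
    exact (h _ _ (p_mem i).1 (p_mono (Nat.le_succ i)) (p_mem _).2).trans (le_abs_self _)
  rcases le_or_gt a b with hab | hab
  · refine ne_top_of_le_ne_top ?_ hle
    have := hN.eVariationOn_eq (left_mem_Icc.2 hab) (right_mem_Icc.2 hab)
    rw [inter_self] at this
    exact this ▸ ENNReal.ofReal_ne_top
  · simp [BoundedVariationOn, Icc_eq_empty_of_lt hab]

theorem boundedVariationOn_integral {F : ℝ → ℂ} {A : ℝ → Set ℝ} {a b : ℝ} (hA : Monotone A)
    (hm : ∀ x, MeasurableSet (A x)) (hk : ∀ x, IntegrableOn k (A x) κ) (c : ℂ)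
    (hF : ∀ x, a ≤ x → F x = c + ∫ t in A x, k t ∂κ) : BoundedVariationOn F (Icc a b) := by
  apply boundedVariationOn_of_dist_le (N := fun x => ∫ t in A x, ‖k t‖ ∂κ)
  intro x y hx hxy _
  rw [hF x hx, hF y (hx.trans hxy), dist_eq_norm, add_sub_add_left_eq_sub,
    ← setIntegral_sdiff (hm x) (hk y) (hA hxy), ← setIntegral_sdiff (hm x) (hk y).norm (hA hxy)]
  exact norm_integral_le_integral_norm _

/-- Here u is the mean of the versions U and U + kκ{·}, which share their one-sided limits at each
point. Hence u has those limits too and takes their mean. -/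
theorem IsPrim.isBalancedBV (h : IsPrim κ univ U k) {u : ℝ → ℂ}
    (hu : ∀ x, u x = U x + κ.real {x} * k x / 2) :
    IsBalancedBV u ∧ leftLim u = U := by
  have hu' : u = (1 / 2 : ℂ) • (U + fun y => U y + k y * κ.real {y}) := by
    ext x
    simp only [hu, Pi.smul_apply, Pi.add_apply, smul_eq_mul]
    ring
  have hl : ∀ x, leftLim u x = U x := by
    intro x
    apply leftLim_eq_of_tendsto
    rw [hu']
    have := ((h.tendsto_left x).1.add (h.tendsto_left x).2).const_smul (1 / 2 : ℂ)
    rw [show U x = (1 / 2 : ℂ) • (U x + U x) by rw [smul_eq_mul]; ring]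
    exact this
  have hr : ∀ x, rightLim u x = U x + k x * κ.real {x} := by
    intro x
    apply rightLim_eq_of_tendsto
    rw [hu']
    have := ((h.tendsto_right x).1.add (h.tendsto_right x).2).const_smul (1 / 2 : ℂ)
    rw [show U x + k x * κ.real {x} = (1 / 2 : ℂ) •
      (U x + k x * κ.real {x} + (U x + k x * κ.real {x})) by rw [smul_eq_mul]; ring]
    exact this
  refine ⟨⟨?_, fun x => by rw [hl, hr, hu]; ring⟩, funext hl⟩
  rw [hu']
  have hbv : LocallyBoundedVariationOn (U + fun y => U y + k y * κ.real {y}) univ := by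
    intro a b _ _
    rw [univ_inter]
    apply boundedVariationOn_add
    · exact boundedVariationOn_integral (κ := κ) (k := k) (A := fun x => Ico a x)
        (fun x y hxy => Ico_subset_Ico_right hxy) (fun _ => measurableSet_Ico)
        (fun x => (h.integrableOn a x).mono_set Ico_subset_Icc_self) _
        fun x hx => h.eq_add_Ico hx
    · exact boundedVariationOn_integral (κ := κ) (k := k) (A := fun x => Icc a x)
        (fun x y hxy => Icc_subset_Icc_right hxy) (fun _ => measurableSet_Icc)
        (fun x => h.integrableOn a x) _
        fun x hx => h.eq_add_Icc hx
  exact (lipschitzWith_smul (1 / 2 : ℂ)).comp_locallyBoundedVariationOn hbv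

theorem countable_setOf_measureReal_singleton_ne (κ : Measure ℝ) [SigmaFinite κ] :
    {x : ℝ | κ.real {x} ≠ 0}.Countable := by
  refine (Measure.countable_meas_level_set_pos (μ := κ) (g := id) measurable_id).mono ?_
  intro x hx
  simp only [mem_ofPred_eq, id] at hx ⊢
  rw [show {a : ℝ | a = x} = {x} from rfl]
  exact pos_iff_ne_zero.2 fun h => hx (by simp [Measure.real, h])

theorem isPrim_test (φ : Test) :
    IsPrim volume univ (fun x => (φ x : ℂ)) (fun x => ((deriv φ x : ℝ) : ℂ)) := by
  have hc : Continuous (deriv φ) := φ.contDiff.continuous_deriv (by simp)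
  intro a _ b _ hab
  refine ⟨((Complex.continuous_ofReal.comp hc).continuousOn.integrableOn_Icc).mono_set
    Ico_subset_Icc_self, ?_⟩
  rw [integral_Ico_eq_integral_Ioc, ← intervalIntegral.integral_of_le hab]
  rw [intervalIntegral.integral_ofReal, intervalIntegral.integral_deriv_eq_sub
    (fun x _ => φ.contDiff.differentiable (by simp) x) (hc.intervalIntegrable _ _)]
  push_cast
  rfl

theorem exists_test_eq_zero (φ : Test) :
    ∃ a b : ℝ, a ≤ b ∧ ∀ x ∉ Ioo a b, φ x = 0 ∧ deriv φ x = 0 := by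
  obtain ⟨R, hR⟩ := φ.hasCompactSupport.isCompact.isBounded.subset_ball 0
  have h : ∀ x ∉ Ioo (-R) R, x ∉ tsupport φ := by
    intro x hx hx'
    have := hR hx'
    rw [Real.ball_eq_Ioo] at this
    simp at this hx
    exact absurd (hx this.1) (not_le.2 this.2)
  refine ⟨-|R|, |R|, by simp, fun x hx => ?_⟩
  have h1 : x ∉ tsupport φ := h x fun h' => hx
    ⟨(neg_le_neg (le_abs_self R)).trans_lt h'.1, h'.2.trans_le (le_abs_self R)⟩
  refine ⟨image_eq_zero_of_notMem_tsupport h1, ?_⟩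
  exact Function.notMem_support.1 fun h2 => h1 (support_deriv_subset h2)

/-- Integration by parts on an interval containing the support of φ. Lebesgue measure has no atoms,
so no correction term appears, and u differs from U only on the countable, hence null, set of atoms
of κ. -/
theorem IsPrim.derivPairing [IsLocallyFiniteMeasure κ] (h : IsPrim κ univ U k) {u : ℝ → ℂ}
    (hu : ∀ x, u x = U x + κ.real {x} * k x / 2) (φ : Test) :
    derivPairing u φ = ∫ x, φ x • k x ∂κ := by
  obtain ⟨a, b, hab, hφ⟩ := exists_test_eq_zero φ
  have hfa := (hφ a (by simp)).1
  have hfb := (hφ b (by simp)).1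
  have hp := (h.mul ordConnected_univ (isPrim_test φ) trivial trivial hab).2.2
  have hv : ∀ x : ℝ, volume.real {x} = 0 := fun x => by simp [Measure.real]
  simp only [hfa, hfb, Complex.ofReal_zero, mul_zero, sub_zero, hv, RCLike.ofReal_zero,
    add_zero] at hp
  have e1 : ∫ x, deriv φ x • u x = ∫ x in Ico a b, U x * ((deriv φ x : ℝ) : ℂ) := by
    rw [← setIntegral_eq_integral_of_forall_compl_eq_zero (s := Ico a b)]
    · apply integral_congr_ae
      apply ae_restrict_of_ae
      filter_upwards [(countable_setOf_measureReal_singleton_ne κ).ae_notMem volume] with x hx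
      simp only [not_not] at hx
      rw [hu, hx]
      simp [mul_comm]
    · intro x hx
      rw [(hφ x fun h' => hx ⟨h'.1.le, h'.2⟩).2, zero_smul]
  have e2 : ∫ x, φ x • k x ∂κ = ∫ x in Ico a b, k x * (φ x : ℂ) ∂κ := by
    rw [← setIntegral_eq_integral_of_forall_compl_eq_zero (s := Ico a b)]
    · congr 1; ext x; simp [mul_comm]
    · intro x hx
      rw [(hφ x fun h' => hx ⟨h'.1.le, h'.2⟩).1, zero_smul]
  rw [PeriodicSystem.derivPairing, e1, e2]
  linear_combination hp

end Limits

/-! ### From the distributional equation back to primitives -/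

section Weak

theorem deriv_smoothTransition_eq_zero {y : ℝ} (hy : y ∉ Ioo (0 : ℝ) 1) :
    deriv Real.smoothTransition y = 0 := by
  rcases le_or_gt y 0 with h | h
  · apply IsLocalMin.deriv_eq_zero
    refine Filter.Eventually.of_forall fun z => ?_
    rw [Real.smoothTransition.zero_of_nonpos h]
    exact Real.smoothTransition.nonneg z
  · apply IsLocalMax.deriv_eq_zero
    refine Filter.Eventually.of_forall fun z => ?_
    rw [Real.smoothTransition.one_of_one_le (not_lt.1 fun h' => hy ⟨h, h'⟩)]
    exact Real.smoothTransition.le_one z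

theorem continuous_deriv_smoothTransition : Continuous (deriv Real.smoothTransition) :=
  (Real.smoothTransition.contDiff (n := 1)).continuous_deriv le_rfl

theorem hasCompactSupport_deriv_smoothTransition :
    HasCompactSupport (deriv Real.smoothTransition) :=
  HasCompactSupport.intro isCompact_Icc fun _ hx =>
    deriv_smoothTransition_eq_zero fun h => hx (Ioo_subset_Icc_self h)

theorem integral_deriv_smoothTransition : ∫ y, deriv Real.smoothTransition y = 1 := by
  rw [← setIntegral_eq_integral_of_forall_compl_eq_zero (s := Ioc (0 : ℝ) 1)
    fun x hx => deriv_smoothTransition_eq_zero fun h => hx (Ioo_subset_Ioc_self h),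
    ← intervalIntegral.integral_of_le zero_le_one, intervalIntegral.integral_deriv_eq_sub
    (fun x _ => (Real.smoothTransition.contDiff (n := 1)).differentiable (by simp) x)
    (continuous_deriv_smoothTransition.intervalIntegrable _ _)]
  simp

theorem IsBalancedBV.exists_norm_le {u : ℝ → ℂ} (hu : IsBalancedBV u) (a b : ℝ) :
    ∃ M, ∀ x ∈ Icc a b, ‖u x‖ ≤ M := by
  have hbv : BoundedVariationOn u (Icc a b) := by
    simpa using hu.locallyBV a b (mem_univ _) (mem_univ _)
  refine ⟨‖u a‖ + (eVariationOn u (Icc a b)).toReal, fun x hx => ?_⟩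
  have h1 := hbv.dist_le hx (left_mem_Icc.2 (hx.1.trans hx.2))
  rw [dist_eq_norm] at h1
  have h2 := norm_le_norm_add_norm_sub' (u x) (u a)
  linarith

/-- A smooth approximation of the indicator function of `[a, ∞)`. -/
noncomputable def smoothStep (a : ℝ) (n : ℕ) (x : ℝ) : ℝ :=
  Real.smoothTransition ((n + 1) * x + (1 - (n + 1) * a))

theorem contDiff_smoothStep (a : ℝ) (n : ℕ) {m : ℕ∞} : ContDiff ℝ m (smoothStep a n) :=
  Real.smoothTransition.contDiff.comp ((contDiff_const.mul contDiff_id).add contDiff_const)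

theorem deriv_smoothStep (a : ℝ) (n : ℕ) (x : ℝ) : deriv (smoothStep a n) x =
    (n + 1) * deriv Real.smoothTransition ((n + 1) * x + (1 - (n + 1) * a)) := by
  have h1 := ((Real.smoothTransition.contDiff (n := 1)).differentiable (by simp)
    ((n + 1) * x + (1 - (n + 1) * a))).hasDerivAt
  have h2 : HasDerivAt (fun x : ℝ => (n + 1) * x + (1 - (n + 1) * a)) (n + 1) x := by
    simpa using ((hasDerivAt_id x).const_mul ((n : ℝ) + 1)).add_const (1 - (n + 1) * a)
  rw [mul_comm]
  exact (h1.comp x h2).deriv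

theorem smoothStep_of_ge {a : ℝ} {n : ℕ} {x : ℝ} (hx : a ≤ x) : smoothStep a n x = 1 := by
  apply Real.smoothTransition.one_of_one_le
  have := mul_le_mul_of_nonneg_left hx (show (0 : ℝ) ≤ n + 1 by positivity)
  linarith

theorem smoothStep_of_le {a : ℝ} {n : ℕ} {x : ℝ} (hx : 1 ≤ (n + 1) * (a - x)) :
    smoothStep a n x = 0 := by
  apply Real.smoothTransition.zero_of_nonpos
  linarith

theorem integrable_deriv_smoothStep_smul {u : ℝ → ℂ} (hu : LocallyIntegrable u) (a : ℝ) (n : ℕ) :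
    Integrable fun x => deriv (smoothStep a n) x • u x := by
  apply hu.integrable_smul_left_of_hasCompactSupport
    ((contDiff_smoothStep a n (m := 1)).continuous_deriv (by simp))
  refine HasCompactSupport.intro (isCompact_Icc (a := a - 1) (b := a)) fun x hx => ?_
  rw [deriv_smoothStep, deriv_smoothTransition_eq_zero, mul_zero]
  rintro ⟨h1, h2⟩
  have hn : (0 : ℝ) ≤ n := Nat.cast_nonneg n
  apply hx
  constructor <;> nlinarith

/-- `smoothStep a n` rises on [a - 1/(n+1), a], entirely to the left of a. After rescaling, u is
sampled at a + (y-1)/(n+1) with 0 < y < 1, so the limit is the left one. -/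
theorem tendsto_integral_deriv_smoothStep {u : ℝ → ℂ} (hu : IsBalancedBV u) (a : ℝ) :
    Tendsto (fun n : ℕ => ∫ x, deriv (smoothStep a n) x • u x) atTop (𝓝 (leftLim u a)) := by
  have e : ∀ n : ℕ, ∫ x, deriv (smoothStep a n) x • u x =
      ∫ y, deriv Real.smoothTransition y • u (a + (y - 1) / (n + 1)) := by
    intro n
    have hn : (0 : ℝ) < n + 1 := by positivity
    set G : ℝ → ℂ := fun y => deriv Real.smoothTransition y • u (a + (y - 1) / (n + 1))
    have h1 := Measure.integral_comp_mul_left (fun y => G (y + (1 - (n + 1) * a))) ((n : ℝ) + 1)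
    rw [integral_add_right_eq_self G] at h1
    rw [show ∫ y, G y = ((n : ℝ) + 1) • (|((n : ℝ) + 1)⁻¹| • ∫ y, G y) by
      rw [abs_of_pos (by positivity), smul_inv_smul₀ hn.ne'], ← h1, ← integral_smul]
    congr 1
    ext x
    simp only [G, deriv_smoothStep, smul_smul]
    congr 2
    field_simp
    ring
  simp only [e]
  have hlim : leftLim u a = ∫ y, deriv Real.smoothTransition y • leftLim u a := by
    rw [integral_smul_const, integral_deriv_smoothTransition, one_smul]
  rw [hlim]
  obtain ⟨M, hM⟩ := hu.exists_norm_le (a - 1) a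
  apply tendsto_integral_of_dominated_convergence (fun y => ‖deriv Real.smoothTransition y‖ * M)
  · intro n
    have h1 : Measurable fun y => u (a + (y - 1) / (n + 1)) :=
      hu.measurable.comp (by fun_prop)
    exact (continuous_deriv_smoothTransition.measurable.smul h1).aestronglyMeasurable
  · exact (continuous_deriv_smoothTransition.integrable_of_hasCompactSupport
      hasCompactSupport_deriv_smoothTransition).norm.mul_const M
  · intro n
    refine ae_of_all _ fun y => ?_
    rw [norm_smul]
    by_cases hy : y ∈ Ioo (0 : ℝ) 1
    · gcongr
      apply hM
      have hn : (0 : ℝ) ≤ n := Nat.cast_nonneg n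
      constructor
      · have : -1 ≤ (y - 1) / (n + 1) := by
          rw [le_div_iff₀ (by positivity)]; nlinarith [hy.1]
        linarith
      · have : (y - 1) / (n + 1) ≤ 0 :=
          div_nonpos_of_nonpos_of_nonneg (by linarith [hy.2]) (by positivity)
        linarith
    · rw [deriv_smoothTransition_eq_zero hy]; simp
  · refine ae_of_all _ fun y => ?_
    by_cases hy : y ∈ Ioo (0 : ℝ) 1
    · apply Tendsto.const_smul
      apply (hu.tendsto_left a).comp
      apply tendsto_nhdsWithin_of_tendsto_nhds_of_eventually_within
      · have h1 := tendsto_one_div_add_atTop_nhds_zero_nat (𝕜 := ℝ)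
        have h2 := (h1.const_mul (y - 1)).const_add a
        simp only [mul_zero, add_zero, mul_one_div] at h2
        exact h2
      · refine Filter.Eventually.of_forall fun n => ?_
        have : (y - 1) / ((n : ℝ) + 1) < 0 :=
          div_neg_of_neg_of_pos (by linarith [hy.2]) (by positivity)
        simpa using this
    · simp [deriv_smoothTransition_eq_zero hy]

theorem IsBalancedBV.tendsto_leftLim_right {u : ℝ → ℂ} (hu : IsBalancedBV u) (x : ℝ) :
    Tendsto (leftLim u) (𝓝[>] x) (𝓝 (rightLim u x)) := by
  rw [Metric.nhds_basis_closedBall.tendsto_right_iff]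
  intro ε hε
  have h1 := (hu.tendsto_right x).eventually (Metric.closedBall_mem_nhds _ hε)
  obtain ⟨b, hb, hsub⟩ := (mem_nhdsGT_iff_exists_Ioo_subset).1 h1
  filter_upwards [Ioo_mem_nhdsGT hb] with y hy
  apply Metric.isClosed_closedBall.mem_of_tendsto (hu.tendsto_left y)
  filter_upwards [Ioo_mem_nhdsLT hy.1] with z hz
  exact hsub ⟨hz.1, hz.2.trans hy.2⟩

/-- The test functions `smoothStep a n - smoothStep b n` converge pointwise to the indicator of
[a,b), endpoints included, and are bounded by 1 on a fixed compact set. The derivative side gives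
the difference of left limits, the other side the integral over [a,b). -/
theorem IsBalancedBV.isPrim_leftLim {κ : Measure ℝ} {u k : ℝ → ℂ} (hu : IsBalancedBV u)
    (hk : LocallyIntegrable k κ) (h : ∀ φ : Test, derivPairing u φ = ∫ x, φ x • k x ∂κ) :
    IsPrim κ univ (leftLim u) k ∧ ∀ x, u x = leftLim u x + κ.real {x} * k x / 2 := by
  have hp : IsPrim κ univ (leftLim u) k := by
    intro a _ b _ hab
    have hkI : IntegrableOn k (Icc (a - 1) b) κ := hk.integrableOn_isCompact isCompact_Icc
    refine ⟨hkI.mono_set fun x hx => ⟨by linarith [hx.1], hx.2.le⟩, ?_⟩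
    have hz : ∀ (n : ℕ), ∀ x ∉ Icc (a - 1) b, smoothStep a n x - smoothStep b n x = 0 := by
      intro n x hx
      have hn : (0 : ℝ) ≤ n := Nat.cast_nonneg n
      rcases lt_or_ge x (a - 1) with h | h
      · rw [smoothStep_of_le, smoothStep_of_le, sub_zero] <;> nlinarith
      · have : b < x := not_le.1 fun h' => hx ⟨h, h'⟩
        rw [smoothStep_of_ge (hab.trans this.le), smoothStep_of_ge this.le, sub_self]
    let φ : ℕ → Test := fun n => ⟨fun x => smoothStep a n x - smoothStep b n x,
      (contDiff_smoothStep a n).sub (contDiff_smoothStep b n),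
      HasCompactSupport.intro isCompact_Icc (hz n), by simp⟩
    have hφ : ∀ n x, φ n x = smoothStep a n x - smoothStep b n x := fun n x => rfl
    have l1 : Tendsto (fun n => derivPairing u (φ n)) atTop (𝓝 (leftLim u b - leftLim u a)) := by
      have := (tendsto_integral_deriv_smoothStep hu b).sub (tendsto_integral_deriv_smoothStep hu a)
      refine this.congr fun n => ?_
      rw [← integral_sub (integrable_deriv_smoothStep_smul (hu.locallyIntegrable _) b n)
        (integrable_deriv_smoothStep_smul (hu.locallyIntegrable _) a n), derivPairing,
        ← integral_neg]
      congr 1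
      ext x
      have : deriv (φ n) x = deriv (smoothStep a n) x - deriv (smoothStep b n) x :=
        deriv_fun_sub ((contDiff_smoothStep a n (m := 1)).differentiable (by simp) x)
          ((contDiff_smoothStep b n (m := 1)).differentiable (by simp) x)
      rw [this, sub_smul]
      ring
    have l2 : Tendsto (fun n => ∫ x, φ n x • k x ∂κ) atTop (𝓝 (∫ x in Ico a b, k x ∂κ)) := by
      rw [← integral_indicator measurableSet_Ico]
      apply tendsto_integral_of_dominated_convergence
        (fun x => ‖(Icc (a - 1) b).indicator k x‖)
      · exact fun n => (integrable_test_smul hk _).aestronglyMeasurable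
      · exact ((integrable_indicator_iff measurableSet_Icc).2 hkI).norm
      · intro n
        refine ae_of_all _ fun x => ?_
        by_cases hx : x ∈ Icc (a - 1) b
        · rw [indicator_of_mem hx, norm_smul]
          refine mul_le_of_le_one_left (norm_nonneg _) ?_
          rw [Real.norm_eq_abs, hφ, abs_le]
          have h1 := Real.smoothTransition.nonneg ((n + 1) * x + (1 - (n + 1) * a))
          have h2 := Real.smoothTransition.nonneg ((n + 1) * x + (1 - (n + 1) * b))
          have h3 := Real.smoothTransition.le_one ((n + 1) * x + (1 - (n + 1) * a))
          have h4 := Real.smoothTransition.le_one ((n + 1) * x + (1 - (n + 1) * b))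
          simp only [smoothStep]
          constructor <;> linarith
        · rw [hφ, hz n x hx]; simp
      · refine ae_of_all _ fun x => tendsto_const_nhds.congr' ?_
        have hev : ∀ c, x < c → ∀ᶠ n : ℕ in atTop, smoothStep c n x = 0 := by
          intro c hc
          obtain ⟨N, hN⟩ := exists_nat_gt (1 / (c - x))
          filter_upwards [eventually_ge_atTop N] with n hn
          apply smoothStep_of_le
          have hn' : (N : ℝ) ≤ n := by exact_mod_cast hn
          rw [← div_le_iff₀ (by linarith)]
          linarith
        rcases lt_or_ge x a with h1 | h1
        · filter_upwards [hev a h1, hev b (h1.trans_le hab)] with n e1 e2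
          rw [hφ, e1, e2, indicator_of_notMem fun h => h1.not_ge h.1]; simp
        · rcases lt_or_ge x b with h2 | h2
          · filter_upwards [hev b h2] with n e2
            rw [hφ, smoothStep_of_ge h1, e2, indicator_of_mem (show x ∈ Ico a b from ⟨h1, h2⟩)]; simp
          · filter_upwards with n
            rw [hφ, smoothStep_of_ge h1, smoothStep_of_ge h2,
              indicator_of_notMem fun h => h2.not_gt h.2]
            simp
    exact tendsto_nhds_unique l1 (by simpa only [h] using l2)
  refine ⟨hp, fun x => ?_⟩
  -- From the right, `leftLim u` tends both to the right limit of u and, as a primitive, to its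
  -- value at x plus the atom.
  have h1 := tendsto_nhds_unique (hu.tendsto_leftLim_right x) (hp.tendsto_right x).1
  rw [hu.balanced x, h1]
  ring

end Weak

end PeriodicSystem

namespace PeriodicSystem

open MeasureTheory Set Function Filter Topology
open scoped ComplexConjugate NNReal ENNReal CompactlySupported

/-! ### Representation of nonnegative distributions by measures -/

section Riesz

/-- Smooth functions inside the compactly supported continuous ones. -/
def smoothSubmodule : Submodule ℝ C_c(ℝ, ℝ) where
  carrier := {g | ContDiff ℝ ((⊤ : ℕ∞) : WithTop ℕ∞) g}
  zero_mem' := by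
    have h : ContDiff ℝ ((⊤ : ℕ∞) : WithTop ℕ∞) (fun _ : ℝ => (0 : ℝ)) := contDiff_const
    exact h
  add_mem' := fun {f g} h h' => by
    have h1 : ContDiff ℝ ((⊤ : ℕ∞) : WithTop ℕ∞) f := h
    have h2 : ContDiff ℝ ((⊤ : ℕ∞) : WithTop ℕ∞) g := h'
    exact h1.add h2
  smul_mem' := fun c g h => by
    have h1 : ContDiff ℝ ((⊤ : ℕ∞) : WithTop ℕ∞) g := h
    exact h1.const_smul c

theorem mem_smoothSubmodule {g : C_c(ℝ, ℝ)} :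
    g ∈ smoothSubmodule ↔ ContDiff ℝ ((⊤ : ℕ∞) : WithTop ℕ∞) g := Iff.rfl

/-- A smooth compactly supported continuous function as a test function. -/
def testOfSmooth (g : smoothSubmodule) : Test :=
  ⟨g.1, mem_smoothSubmodule.1 g.2, g.1.hasCompactSupport, by simp⟩

/-- M. Riesz's extension theorem extends the positive functional from smooth to continuous compactly
supported functions, where the Riesz–Markov–Kakutani theorem applies. Its cofinality hypothesis
holds because M times a smooth bump dominates any function bounded by M and supported where the bump
is 1. -/
theorem exists_isLocallyFiniteMeasure_of_isNonneg {r : RealDistribution} (hr : IsNonneg r) :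
    ∃ μ : Measure ℝ, IsLocallyFiniteMeasure μ ∧ ∀ φ : Test, r φ = ∫ x, φ x ∂μ := by
  let f : C_c(ℝ, ℝ) →ₗ.[ℝ] ℝ :=
    { domain := smoothSubmodule
      toFun :=
        { toFun := fun g => r (testOfSmooth g)
          map_add' := fun g g' => by
            rw [← map_add]; rfl
          map_smul' := fun c g => by
            rw [RingHom.id_apply, ← map_smul]; rfl } }
  let s : PointedCone ℝ C_c(ℝ, ℝ) :=
    { carrier := {g | ∀ x, 0 ≤ g x}
      zero_mem' := fun x => le_rfl
      add_mem' := fun h h' x => add_nonneg (h x) (h' x)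
      smul_mem' := fun c _ h x => mul_nonneg c.2 (h x) }
  obtain ⟨g, hg, hpos⟩ := riesz_extension s f (fun g hgs => hr (testOfSmooth g) hgs) (by
    intro y
    obtain ⟨M, hM⟩ := y.continuous.bounded_above_of_compact_support y.hasCompactSupport
    obtain ⟨R, hR⟩ := y.hasCompactSupport.isCompact.isBounded.subset_ball 0
    let b : ContDiffBump (0 : ℝ) := ⟨|R| + 1, |R| + 2, by positivity, by linarith⟩
    let x : C_c(ℝ, ℝ) := ⟨⟨fun t => M * b t, continuous_const.mul b.continuous⟩,
      b.hasCompactSupport.mul_left⟩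
    refine ⟨⟨x, mem_smoothSubmodule.2 (contDiff_const.mul b.contDiff)⟩, fun t => ?_⟩
    change 0 ≤ M * b t + y t
    have hM0 : 0 ≤ M := (norm_nonneg _).trans (hM 0)
    by_cases ht : t ∈ tsupport y
    · have h1 := hR ht
      rw [b.one_of_mem_closedBall]
      · have : |y t| ≤ M := hM t
        linarith [neg_abs_le (y t)]
      · simp only [Metric.mem_closedBall, Metric.mem_ball] at h1 ⊢
        exact h1.le.trans ((le_abs_self R).trans (by simp [b]))
    · rw [image_eq_zero_of_notMem_tsupport ht]
      have := b.nonneg (x := t)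
      positivity)
  let Λ : C_c(ℝ, ℝ) →ₚ[ℝ] ℝ := PositiveLinearMap.mk₀ g fun x hx => hpos x hx
  refine ⟨RealRMK.rieszMeasure Λ, inferInstance, fun φ => ?_⟩
  let φc : C_c(ℝ, ℝ) := ⟨⟨φ, φ.continuous⟩, φ.hasCompactSupport⟩
  have h1 : ∫ x, φ x ∂(RealRMK.rieszMeasure Λ) = Λ φc := RealRMK.integral_rieszMeasure Λ φc
  rw [h1]
  exact (hg ⟨φc, mem_smoothSubmodule.2 φ.contDiff⟩).symm

theorem toMeasure_spec {w : RealDistribution} (hw : IsNonneg w) (φ : Test) :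
    w φ = ∫ x, φ x ∂(toMeasure w) := by
  have h := exists_isLocallyFiniteMeasure_of_isNonneg hw
  unfold toMeasure
  rw [dif_pos h]
  exact h.choose_spec.2 φ

end Riesz

/-! ### Consequences of periodicity: bounded atoms and infinite mass -/

section Periodic

/-- The translate `φ(· + c)` of a test function. -/
noncomputable def translate (φ : Test) (c : ℝ) : Test :=
  ⟨fun x => φ (x + c), φ.contDiff.comp (contDiff_id.add contDiff_const),
    φ.hasCompactSupport.comp_homeomorph (Homeomorph.addRight c), by simp⟩

@[simp]
theorem translate_apply (φ : Test) (c x : ℝ) : translate φ c x = φ (x + c) := rfl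

theorem HasPeriod.apply_translate {r : RealDistribution} {ω : ℝ} (h : HasPeriod r ω) (φ : Test)
    (n : ℤ) : r (translate φ (n * ω)) = r φ := by
  have h1 : ∀ n : ℤ, r (translate φ (n * ω)) = r (translate φ ((n + 1 : ℤ) * ω)) := fun n =>
    h _ _ fun x => by simp only [translate_apply]; congr 1; push_cast; ring
  induction n using Int.induction_on with
  | zero => congr 1; ext x; simp
  | succ n ih => rw [← h1, ih]
  | pred n ih => rw [h1, sub_add_cancel, ih]

theorem tendsto_integral_bump (μ : Measure ℝ) [IsLocallyFiniteMeasure μ] (x : ℝ)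
    (b : ℕ → ContDiffBump x) (hb : ∀ n, (b n).rOut = 1 / ((n : ℝ) + 1)) :
    Tendsto (fun n => ∫ y, b n y ∂μ) atTop (𝓝 (μ.real {x})) := by
  have e : μ.real {x} = ∫ y, ({x} : Set ℝ).indicator 1 y ∂μ := by
    rw [integral_indicator_one (measurableSet_singleton x)]
  rw [e]
  apply tendsto_integral_of_dominated_convergence ((Metric.closedBall x 1).indicator 1)
  · exact fun n => (b n).continuous.aestronglyMeasurable
  · exact (integrable_indicator_iff Metric.isClosed_closedBall.measurableSet).2
      (integrableOn_const (isCompact_closedBall x 1).measure_lt_top.ne)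
  · refine fun n => ae_of_all _ fun y => ?_
    rw [Real.norm_eq_abs, abs_of_nonneg (b n).nonneg]
    by_cases hy : y ∈ Metric.closedBall x 1
    · rw [indicator_of_mem hy]
      exact (b n).le_one
    · rw [indicator_of_notMem hy, (b n).zero_of_le_dist]
      rw [hb]
      have h1 : 1 < dist y x := not_le.1 hy
      refine le_trans ?_ h1.le
      rw [div_le_one (by positivity)]
      have : (0 : ℝ) ≤ n := Nat.cast_nonneg n
      linarith
  · refine ae_of_all _ fun y => tendsto_const_nhds.congr' ?_
    by_cases hy : y = x
    · subst hy
      filter_upwards with n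
      rw [(b n).one_of_mem_closedBall (Metric.mem_closedBall_self (b n).rIn_pos.le)]
      simp
    · have h0 : 0 < dist y x := dist_pos.2 hy
      filter_upwards [(tendsto_one_div_add_atTop_nhds_zero_nat (𝕜 := ℝ)).eventually
        (gt_mem_nhds h0)] with n hn
      rw [(b n).zero_of_le_dist (by rw [hb]; exact hn.le)]
      simp [hy]

/-- The net atom at x is the limit of r on bumps shrinking to x. Translation by periods moves all
these bumps into one compact interval, where order 0 bounds r by C times the sup norm, which is at
most 1. -/
theorem exists_atom_bound {r : RealDistribution} {ω : ℝ} (hω : 0 < ω) (h0 : HasOrderZero r)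
    (hr : HasPeriod r ω) {μ ν : Measure ℝ} [IsLocallyFiniteMeasure μ] [IsLocallyFiniteMeasure ν]
    (hμ : ∀ φ : Test, r φ = ∫ x, φ x ∂μ - ∫ x, φ x ∂ν) :
    ∃ C, ∀ x, |μ.real {x} - ν.real {x}| ≤ C := by
  obtain ⟨C, hC0, hC⟩ := h0 (Icc (-1) (ω + 1)) isCompact_Icc
  refine ⟨C, fun x => ?_⟩
  let b : ℕ → ContDiffBump x := fun n =>
    ⟨1 / ((n : ℝ) + 1) / 2, 1 / ((n : ℝ) + 1), by positivity, half_lt_self (by positivity)⟩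
  let φ : ℕ → Test := fun n => ⟨b n, (b n).contDiff, (b n).hasCompactSupport, by simp⟩
  have hlim : Tendsto (fun n => |r (φ n)|) atTop (𝓝 |μ.real {x} - ν.real {x}|) := by
    simp only [hμ]
    exact ((tendsto_integral_bump μ x b fun _ => rfl).sub
      (tendsto_integral_bump ν x b fun _ => rfl)).abs
  refine le_of_tendsto hlim (Filter.Eventually.of_forall fun n => ?_)
  -- The translated bump is centred in [0, ω) and has radius at most 1, hence is supported in [-1, ω
  -- + 1].
  rw [← hr.apply_translate (φ n) ⌊x / ω⌋]
  have h1 : (⌊x / ω⌋ : ℝ) * ω ≤ x := by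
    rw [← le_div_iff₀ hω]; exact Int.floor_le _
  have h2 : x < (⌊x / ω⌋ : ℝ) * ω + ω := by
    have := Int.lt_floor_add_one (x / ω)
    rw [div_lt_iff₀ hω] at this
    linarith
  refine (hC _ ?_).trans (mul_le_of_le_one_right hC0 (ciSup_le fun y => ?_))
  · apply closure_minimal _ isClosed_Icc
    intro y hy
    by_contra hy'
    apply hy
    change b n (y + ⌊x / ω⌋ * ω) = 0
    apply (b n).zero_of_le_dist
    change 1 / ((n : ℝ) + 1) ≤ _
    refine le_trans ((div_le_one (by positivity)).2 (by
      have : (0 : ℝ) ≤ n := Nat.cast_nonneg n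
      linarith)) ?_
    rw [Real.dist_eq]
    by_contra hlt
    rw [not_le, abs_lt] at hlt
    exact hy' ⟨by linarith [hlt.1], by linarith [hlt.2]⟩
  · change |b n (y + ⌊x / ω⌋ * ω)| ≤ 1
    rw [abs_of_nonneg (b n).nonneg]
    exact (b n).le_one

/-- The atoms of a periodic distribution of order `0` are bounded. There is nothing to prove in the
case that `q` has no Jordan pair, as both measures are then `0` by convention. -/
theorem exists_jordanPair_atom_bound {q : RealDistribution} {ω : ℝ} (hω : 0 < ω)
    (h0 : HasOrderZero q) (hq : HasPeriod q ω) :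
    ∃ C, ∀ x, |(jordanPair q).1.real {x} - (jordanPair q).2.real {x}| ≤ C := by
  by_cases h : ∃ m : Measure ℝ × Measure ℝ, IsJordanPair q m.1 m.2
  · apply exists_atom_bound hω h0 hq
    have : jordanPair q = h.choose := by unfold jordanPair; rw [dif_pos h]
    rw [this]
    exact h.choose_spec.apply_eq
  · have : jordanPair q = (0, 0) := by unfold jordanPair; rw [dif_neg h]
    exact ⟨0, fun x => by simp [this]⟩

theorem exists_toMeasure_atom_bound {w : RealDistribution} {ω : ℝ} (hω : 0 < ω)
    (h0 : HasOrderZero w) (hw : HasPeriod w ω) (hn : IsNonneg w) :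
    ∃ C, ∀ x, (toMeasure w).real {x} ≤ C := by
  obtain ⟨C, hC⟩ := exists_atom_bound hω h0 hw (μ := toMeasure w) (ν := 0)
    fun φ => by simp [toMeasure_spec hn]
  exact ⟨C, fun x => (le_abs_self _).trans (by simpa using hC x)⟩

/-- If S had finite mass, translates of φ that end up in S and escape every point would have
integrals tending to 0 by dominated convergence, while periodicity keeps each of them equal to w φ.
-/
theorem toMeasure_eq_top {w : RealDistribution} {ω : ℝ} (hw : HasPeriod w ω) (hn : IsNonneg w)
    {φ : Test} (hφ : w φ ≠ 0) {S : Set ℝ} (hS : MeasurableSet S) (N : ℕ → ℤ)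
    (h1 : ∀ᶠ k in atTop, ∀ x ∉ S, φ (x + N k * ω) = 0)
    (h2 : ∀ x, ∀ᶠ k in atTop, φ (x + N k * ω) = 0) : toMeasure w S = ∞ := by
  by_contra hfin
  obtain ⟨M, hM⟩ := φ.continuous.bounded_above_of_compact_support φ.hasCompactSupport
  have hlim : Tendsto (fun k => ∫ x, translate φ (N k * ω) x ∂(toMeasure w)) atTop
      (𝓝 (∫ x, (0 : ℝ) ∂(toMeasure w))) := by
    apply tendsto_integral_filter_of_dominated_convergence (S.indicator fun _ => M)
    · exact Filter.Eventually.of_forall fun k => (translate φ _).continuous.aestronglyMeasurable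
    · filter_upwards [h1] with k hk
      refine ae_of_all _ fun x => ?_
      by_cases hx : x ∈ S
      · rw [indicator_of_mem hx]; exact hM _
      · rw [indicator_of_notMem hx, translate_apply, hk x hx, norm_zero]
    · exact (integrable_indicator_iff hS).2 (integrableOn_const hfin)
    · refine ae_of_all _ fun x => tendsto_const_nhds.congr' ?_
      filter_upwards [h2 x] with k hk
      exact hk.symm
  simp only [← toMeasure_spec hn, hw.apply_translate, integral_zero] at hlim
  exact hφ (tendsto_nhds_unique tendsto_const_nhds hlim)

theorem toMeasure_Ici_Iic_eq_top {w : RealDistribution} {ω : ℝ} (hω : 0 < ω)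
    (hw : HasPeriod w ω) (hn : IsNonneg w) (hw0 : w ≠ 0) (X : ℝ) :
    toMeasure w (Ici X) = ∞ ∧ toMeasure w (Iic X) = ∞ := by
  obtain ⟨φ, hφ⟩ : ∃ φ, w φ ≠ 0 := by
    by_contra! h
    exact hw0 (by ext φ; exact h φ)
  obtain ⟨a, b, hab, hz⟩ := exists_test_eq_zero φ
  have ht : Tendsto (fun n : ℕ => (n : ℝ) * ω) atTop atTop :=
    tendsto_natCast_atTop_atTop.atTop_mul_const hω
  constructor
  · apply toMeasure_eq_top hw hn hφ measurableSet_Ici (fun n => -(n : ℤ))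
    · filter_upwards [ht.eventually_ge_atTop (X - a)] with n hn x hx
      apply (hz _ _).1
      rintro ⟨h1, h2⟩
      push_cast at h1
      simp only [mem_Ici, not_le] at hx
      linarith
    · intro x
      filter_upwards [ht.eventually_ge_atTop (x - a)] with n hn
      apply (hz _ _).1
      rintro ⟨h1, h2⟩
      push_cast at h1
      linarith
  · apply toMeasure_eq_top hw hn hφ measurableSet_Iic (fun n => (n : ℤ))
    · filter_upwards [ht.eventually_ge_atTop (b - X)] with n hn x hx
      apply (hz _ _).1
      rintro ⟨h1, h2⟩
      push_cast at h2
      simp only [mem_Iic, not_le] at hx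
      linarith
    · intro x
      filter_upwards [ht.eventually_ge_atTop (b - x)] with n hn
      apply (hz _ _).1
      rintro ⟨h1, h2⟩
      push_cast at h2
      linarith

theorem not_forall_le_of_integrable {α : Type*} [MeasurableSpace α] {W : Measure α} {S : Set α}
    (hS : W S = ∞) {F : α → ℝ} (hF : Integrable F W) {ε : ℝ} (hε : 0 < ε) :
    ¬ ∀ x ∈ S, ε ≤ F x := by
  intro h
  have h1 := hF.measure_norm_ge_lt_top hε
  refine (lt_of_le_of_lt (measure_mono fun x hx => ?_) h1).ne hS
  exact (h x hx).trans (le_abs_self _)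

end Periodic

/-! ### A common dominating measure and the two forms of the equation -/

section Density

theorem exists_density {μ κ : Measure ℝ} [SigmaFinite μ] [SigmaFinite κ] (h : μ ≤ κ) :
    ∃ r : ℝ → ℝ≥0, Measurable r ∧ (∀ t, r t ≤ 1) ∧ μ = κ.withDensity fun t => r t := by
  -- Truncating at 1 changes the density only on a null set and makes the bound hold everywhere.
  refine ⟨fun t => (min (μ.rnDeriv κ t) 1).toNNReal,
    ((μ.measurable_rnDeriv κ).min measurable_const).ennreal_toNNReal, fun t => ?_, ?_⟩
  · have := ENNReal.toNNReal_mono ENNReal.one_ne_top (min_le_right (μ.rnDeriv κ t) 1)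
    simpa using this
  · conv_lhs => rw [← Measure.withDensity_rnDeriv_eq μ κ (Measure.absolutelyContinuous_of_le h)]
    apply withDensity_congr_ae
    filter_upwards [Measure.rnDeriv_le_one_of_le h] with t ht
    rw [ENNReal.coe_toNNReal (ne_top_of_le_ne_top ENNReal.one_ne_top (min_le_right _ _)),
      min_eq_left (show μ.rnDeriv κ t ≤ 1 from ht)]

variable {κ : Measure ℝ} {r : ℝ → ℝ≥0}

theorem integrableOn_withDensity_iff (hr : Measurable r) {S : Set ℝ} (hS : MeasurableSet S)
    {f : ℝ → ℂ} : IntegrableOn f S (κ.withDensity fun t => r t) ↔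
      IntegrableOn (fun t => ((r t : ℝ) : ℂ) * f t) S κ := by
  rw [IntegrableOn, restrict_withDensity hS, integrable_withDensity_iff_integrable_smul hr]
  rfl

theorem setIntegral_withDensity (hr : Measurable r) {S : Set ℝ} (hS : MeasurableSet S)
    (f : ℝ → ℂ) : ∫ t in S, f t ∂(κ.withDensity fun t => r t) =
      ∫ t in S, ((r t : ℝ) : ℂ) * f t ∂κ := by
  rw [setIntegral_withDensity_eq_setIntegral_smul hr _ hS]
  rfl

theorem withDensity_real_singleton (x : ℝ) :
    (κ.withDensity fun t => r t).real {x} = r x * κ.real {x} := by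
  simp [Measure.real, withDensity_apply, mul_comm]

theorem locallyIntegrable_withDensity_iff (hr : Measurable r) {f : ℝ → ℂ} :
    LocallyIntegrable f (κ.withDensity fun t => r t) ↔
      LocallyIntegrable (fun t => ((r t : ℝ) : ℂ) * f t) κ := by
  rw [locallyIntegrable_iff, locallyIntegrable_iff]
  exact forall₂_congr fun K hK => integrableOn_withDensity_iff hr hK.measurableSet

/-- `κ` is a positive measure such that `q = p κ` and `w = r κ`, with densities bounded by `1`. -/
structure IsDensity (q w : RealDistribution) (κ : Measure ℝ) (p : ℝ → ℝ) (r : ℝ → ℝ≥0) :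
    Prop where
  isLocallyFinite : IsLocallyFiniteMeasure κ
  measurable_left : Measurable p
  measurable_right : Measurable r
  abs_left_le : ∀ t, |p t| ≤ 1
  right_le : ∀ t, r t ≤ 1
  toMeasure_eq : toMeasure w = κ.withDensity fun t => r t
  mulPairing_eq : ∀ u : ℝ → ℂ, LocallyIntegrable u κ → ∀ φ : Test,
    mulPairing q u φ = ∫ x, φ x • (p x * u x : ℂ) ∂κ
  atom_eq : ∀ x, p x * κ.real {x} = (jordanPair q).1.real {x} - (jordanPair q).2.real {x}

theorem exists_isDensity (q w : RealDistribution) : ∃ κ p r, IsDensity q w κ p r := by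
  set μ := (jordanPair q).1
  set ν := (jordanPair q).2
  set W := toMeasure w
  set κ := μ + ν + W
  have hμκ : μ ≤ κ := by
    rw [show κ = μ + (ν + W) from add_assoc _ _ _]; exact Measure.le_add_right le_rfl
  have hνκ : ν ≤ κ := by
    rw [show κ = ν + (μ + W) by simp only [κ]; abel]; exact Measure.le_add_right le_rfl
  have hWκ : W ≤ κ := Measure.le_add_left le_rfl
  have hκ : IsLocallyFiniteMeasure κ := by
    refine ⟨fun x => ?_⟩
    obtain ⟨s, hs, h1⟩ := μ.finiteAt_nhds x
    obtain ⟨t, ht, h2⟩ := ν.finiteAt_nhds x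
    obtain ⟨v, hv, h3⟩ := W.finiteAt_nhds x
    refine ⟨s ∩ (t ∩ v), inter_mem hs (inter_mem ht hv), ?_⟩
    simp only [κ, Measure.add_apply]
    refine ENNReal.add_lt_top.2 ⟨ENNReal.add_lt_top.2 ⟨?_, ?_⟩, ?_⟩
    · exact (measure_mono inter_subset_left).trans_lt h1
    · exact (measure_mono (inter_subset_right.trans inter_subset_left)).trans_lt h2
    · exact (measure_mono (inter_subset_right.trans inter_subset_right)).trans_lt h3
  obtain ⟨r₁, m₁, b₁, e₁⟩ := exists_density hμκ
  obtain ⟨r₂, m₂, b₂, e₂⟩ := exists_density hνκ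
  obtain ⟨r, m, b, e⟩ := exists_density hWκ
  refine ⟨κ, fun t => r₁ t - r₂ t, r, hκ, ?_, m, ?_, b, e, ?_, ?_⟩
  · exact m₁.coe_nnreal_real.sub m₂.coe_nnreal_real
  · intro t
    have h1 : (r₁ t : ℝ) ≤ 1 := b₁ t
    have h2 : (r₂ t : ℝ) ≤ 1 := b₂ t
    rw [abs_le]
    constructor <;> linarith [(r₁ t).2, (r₂ t).2]
  · intro u hu φ
    have key : ∀ (ρ : Measure ℝ) (s : ℝ → ℝ≥0), Measurable s → ρ ≤ κ →
        ρ = κ.withDensity (fun t => s t) →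
        Integrable (fun x => ((s x : ℝ) : ℂ) * (φ x • u x)) κ ∧
        ∫ x, φ x • u x ∂ρ = ∫ x, ((s x : ℝ) : ℂ) * (φ x • u x) ∂κ := by
      intro ρ s hs hle hρ
      have h1 := setIntegral_withDensity (κ := κ) hs MeasurableSet.univ fun x => φ x • u x
      have h2 := integrableOn_withDensity_iff (κ := κ) hs MeasurableSet.univ
        (f := fun x => φ x • u x)
      rw [← hρ] at h1 h2
      simp only [setIntegral_univ, integrableOn_univ] at h1 h2
      exact ⟨h2.1 ((integrable_test_smul hu φ).mono_measure hle), h1⟩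
    obtain ⟨i1, j1⟩ := key μ r₁ m₁ hμκ e₁
    obtain ⟨i2, j2⟩ := key ν r₂ m₂ hνκ e₂
    rw [mulPairing, j1, j2, ← integral_sub i1 i2]
    congr 1
    ext x
    simp only [Complex.real_smul]
    push_cast
    ring
  · intro x
    rw [sub_mul, ← withDensity_real_singleton, ← withDensity_real_singleton, ← e₁, ← e₂]

variable {q w : RealDistribution} {p : ℝ → ℝ} {J : ℂ} {U u f : ℝ → ℂ}

theorem IsDensity.locallyIntegrable_rhs (D : IsDensity q w κ p r) (hu : IsBalancedBV u)
    (hf : LocallyIntegrable f (toMeasure w)) :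
    LocallyIntegrable (fun t => ((r t : ℝ) : ℂ) * f t) κ ∧
    LocallyIntegrable (fun t => (p t : ℂ) * u t) κ := by
  have := D.isLocallyFinite
  rw [D.toMeasure_eq, locallyIntegrable_withDensity_iff D.measurable_right] at hf
  refine ⟨hf, locallyIntegrable_iff.2 fun K hK => ?_⟩
  refine ((hu.locallyIntegrable κ).integrableOn_isCompact hK).bdd_mul (c := 1)
    (Complex.measurable_ofReal.comp D.measurable_left).aestronglyMeasurable (ae_of_all _ fun t => ?_)
  simpa using D.abs_left_le t

theorem IsDensity.solvesEq_iff (D : IsDensity q w κ p r) (hJ0 : J ≠ 0) (hu : IsBalancedBV u)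
    (hf : LocallyIntegrable f (toMeasure w)) :
    SolvesEq J q w u f ↔ ∀ φ : Test, derivPairing u φ =
      ∫ x, φ x • (((r x : ℝ) * f x - p x * u x) / J : ℂ) ∂κ := by
  have := D.isLocallyFinite
  obtain ⟨h1, h2⟩ := D.locallyIntegrable_rhs hu hf
  refine forall_congr' fun φ => ?_
  have e1 : ∫ x, φ x • f x ∂(toMeasure w) = ∫ x, φ x • ((r x : ℝ) * f x : ℂ) ∂κ := by
    have := setIntegral_withDensity (κ := κ) D.measurable_right MeasurableSet.univ
      fun x => φ x • f x
    rw [← D.toMeasure_eq, setIntegral_univ, setIntegral_univ] at this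
    rw [this]
    congr 1
    ext x
    simp only [Complex.real_smul]
    ring
  have e2 : ∫ x, φ x • (((r x : ℝ) * f x - p x * u x) / J : ℂ) ∂κ =
      (∫ x, φ x • ((r x : ℝ) * f x : ℂ) ∂κ - ∫ x, φ x • (p x * u x : ℂ) ∂κ) / J := by
    rw [← integral_sub (integrable_test_smul h1 φ) (integrable_test_smul h2 φ),
      ← integral_div]
    congr 1
    ext x
    simp only [Complex.real_smul]
    ring
  rw [D.mulPairing_eq u (hu.locallyIntegrable κ) φ, e1, e2, eq_div_iff hJ0, eq_sub_iff_add_eq,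
    mul_comm]

/-- This and `IsDensity.solvesEq` make the distributional equation equivalent to the integral
equation with U the left limits of u; all further arguments use the latter. -/
theorem IsDensity.isSol (D : IsDensity q w κ p r) (hJ0 : J ≠ 0) (hu : IsBalancedBV u)
    (hf : LocallyIntegrable f (toMeasure w)) (h : SolvesEq J q w u f) :
    IsSol κ J p (fun t => r t) univ (leftLim u) u f := by
  have := D.isLocallyFinite
  obtain ⟨h1, h2⟩ := D.locallyIntegrable_rhs hu hf
  have hk : LocallyIntegrable (fun x => (((r x : ℝ) * f x - p x * u x) / J : ℂ)) κ := by
    have := (h1.sub h2).smul J⁻¹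
    convert this using 1
    ext x
    simp only [Pi.smul_apply, Pi.sub_apply, smul_eq_mul]
    ring
  obtain ⟨h3, h4⟩ := hu.isPrim_leftLim hk ((D.solvesEq_iff hJ0 hu hf).1 h)
  exact ⟨h3, fun t _ => h4 t⟩

theorem IsDensity.solvesEq (D : IsDensity q w κ p r) (hJ0 : J ≠ 0)
    (hf : LocallyIntegrable f (toMeasure w)) (h : IsSol κ J p (fun t => r t) univ U u f) :
    IsBalancedBV u ∧ leftLim u = U ∧ SolvesEq J q w u f := by
  have := D.isLocallyFinite
  obtain ⟨h1, h2⟩ := h.isPrim.isBalancedBV fun x => h.eq x trivial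
  exact ⟨h1, h2, (D.solvesEq_iff hJ0 h1 hf).2 fun φ =>
    h.isPrim.derivPairing (fun x => h.eq x trivial) φ⟩

end Density

end PeriodicSystem

/-! ### Spectra of self-adjoint relations -/

namespace LinearRelation

variable {H : Type*} [NormedAddCommGroup H] [InnerProductSpace ℂ H] {T : Submodule ℂ (H × H)}

open scoped ComplexConjugate InnerProductSpace

theorem mem_shift {z : ℂ} {u g : H} : (u, g) ∈ shift T z ↔ (u, g + z • u) ∈ T := by
  simp only [shift, Submodule.mem_map]
  constructor
  · rintro ⟨⟨a, b⟩, h, he⟩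
    obtain ⟨rfl, rfl⟩ : a = u ∧ b - z • a = g := Prod.mk.inj he
    simpa using h
  · intro h
    exact ⟨_, h, by simp⟩

theorem mem_ker_shift {z : ℂ} {u : H} : u ∈ ker (shift T z) ↔ (u, z • u) ∈ T := by
  rw [ker, Submodule.mem_comap, LinearMap.inl_apply, mem_shift, zero_add]

theorem mem_ran_shift {z : ℂ} {g : H} : g ∈ ran (shift T z) ↔ ∃ u, (u, g + z • u) ∈ T := by
  simp only [ran, Submodule.mem_map, Prod.exists, LinearMap.snd_apply, mem_shift]
  exact ⟨fun ⟨a, b, h, e⟩ => ⟨a, e ▸ h⟩, fun ⟨a, h⟩ => ⟨a, g, h, rfl⟩⟩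

theorem IsSelfAdjoint.mem_iff (hT : IsSelfAdjoint T) {v g : H} :
    (v, g) ∈ T ↔ ∀ a b, (a, b) ∈ T → ⟪b, v⟫_ℂ - ⟪a, g⟫_ℂ = 0 := by
  conv_lhs => rw [← show T.adjoint = T from hT]
  exact Submodule.mem_adjoint_iff T (v, g)

/-- Any vector orthogonal to the range of T - z lies in the kernel of T* - conj z, and T* = T. -/
theorem IsSelfAdjoint.dense_ran_shift [CompleteSpace H] (hT : IsSelfAdjoint T) {z : ℂ}
    (h : ker (shift T (conj z)) = ⊥) : Dense (ran (shift T z) : Set H) := by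
  rw [Submodule.dense_iff_topologicalClosure_eq_top, Submodule.topologicalClosure_eq_top_iff,
    eq_bot_iff, ← h]
  intro g hg
  rw [mem_ker_shift, hT.mem_iff]
  intro a b hab
  have := (Submodule.mem_orthogonal _ _).1 hg (b - z • a)
    (mem_ran_shift.2 ⟨a, by simpa using hab⟩)
  rw [inner_sub_left, inner_smul_left] at this
  rwa [inner_smul_right]

theorem IsSelfAdjoint.im_inner (hT : IsSelfAdjoint T) {a b : H} (h : (a, b) ∈ T) :
    (⟪a, b⟫_ℂ).im = 0 := by
  have h1 := hT.mem_iff.1 h a b h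
  rw [sub_eq_zero, ← inner_conj_symm] at h1
  exact Complex.conj_eq_iff_im.1 h1

/-- Since ⟪a, b⟫ is real, the imaginary part of ⟪a, b - za⟫ is -Im(z)‖a‖²; the Cauchy–Schwarz
inequality does the rest. -/
theorem IsSelfAdjoint.abs_im_mul_norm_le (hT : IsSelfAdjoint T) (z : ℂ) {a b : H}
    (h : (a, b) ∈ T) : |z.im| * ‖a‖ ≤ ‖b - z • a‖ := by
  have h1 : (⟪a, b - z • a⟫_ℂ).im = -(z.im * ‖a‖ ^ 2) := by
    rw [inner_sub_right, inner_smul_right, Complex.sub_im, hT.im_inner h,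
      inner_self_eq_norm_sq_to_K]
    have : ((‖a‖ : ℂ)) ^ 2 = ((‖a‖ ^ 2 : ℝ) : ℂ) := by push_cast; rfl
    simp only [Complex.coe_algebraMap]
    rw [this, Complex.im_mul_ofReal]
    ring
  have h2 : |z.im| * ‖a‖ ^ 2 ≤ ‖a‖ * ‖b - z • a‖ := by
    calc |z.im| * ‖a‖ ^ 2 = |(⟪a, b - z • a⟫_ℂ).im| := by
          rw [h1, abs_neg, abs_mul, abs_of_nonneg (sq_nonneg ‖a‖)]
      _ ≤ ‖⟪a, b - z • a⟫_ℂ‖ := Complex.abs_im_le_norm _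
      _ ≤ _ := norm_inner_le_norm _ _
  rcases eq_or_ne a 0 with rfl | ha
  · simp
  · have := norm_pos_iff.2 ha
    nlinarith

theorem IsSelfAdjoint.isClosed (hT : IsSelfAdjoint T) : IsClosed (T : Set (H × H)) := by
  have : (T : Set (H × H)) =
      ⋂ x : T, {y | ⟪x.1.2, y.1⟫_ℂ - ⟪x.1.1, y.2⟫_ℂ = 0} := by
    ext ⟨v, g⟩
    rw [SetLike.mem_coe, hT.mem_iff]
    simp
  rw [this]
  exact isClosed_iInter fun x => isClosed_eq (by fun_prop) continuous_const

/-- For nonreal z the map (a, b) ↦ b - za is bounded below on the closed, hence complete, graph T,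
so its range is closed. The range is also dense, because the kernel at conj z is trivial. -/
theorem IsSelfAdjoint.mem_resolventSet [CompleteSpace H] (hT : IsSelfAdjoint T) {z : ℂ}
    (hz : z.im ≠ 0) : z ∈ resolventSet T := by
  have hker : ∀ z : ℂ, z.im ≠ 0 → ker (shift T z) = ⊥ := by
    intro z hz
    rw [eq_bot_iff]
    intro u hu
    have h1 := hT.abs_im_mul_norm_le z (mem_ker_shift.1 hu)
    rw [sub_self, norm_zero] at h1
    have h2 : 0 < |z.im| := abs_pos.2 hz
    have h3 := norm_nonneg u
    exact norm_eq_zero.1 (by nlinarith)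
  refine ⟨hker z hz, ?_⟩
  have hdense := hT.dense_ran_shift (z := z) (hker _ (by simpa using hz))
  have hTc : CompleteSpace T := hT.isClosed.isComplete.completeSpace_coe
  let L : T →L[ℂ] H := (ContinuousLinearMap.snd ℂ H H - z • ContinuousLinearMap.fst ℂ H H).comp
    T.subtypeL
  have hL : ∀ x : T, L x = x.1.2 - z • x.1.1 := fun x => rfl
  have hz' : 0 < |z.im| := abs_pos.2 hz
  have hb : ∀ x : T, ‖x‖ ≤ (1 + (1 + ‖z‖) / |z.im|) * ‖L x‖ := by
    intro x
    have h1 := hT.abs_im_mul_norm_le z x.2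
    rw [← hL] at h1
    have h2 : ‖x.1.1‖ ≤ ‖L x‖ / |z.im| := by
      rw [le_div_iff₀ hz', mul_comm]; exact h1
    have h3 : ‖x.1.2‖ ≤ ‖L x‖ + ‖z‖ * ‖x.1.1‖ := by
      rw [← norm_smul, hL]
      simpa using norm_add_le (x.1.2 - z • x.1.1) (z • x.1.1)
    have h4 : ‖z‖ * ‖x.1.1‖ ≤ ‖z‖ * (‖L x‖ / |z.im|) := by gcongr
    have h5 : 0 ≤ ‖L x‖ / |z.im| := by positivity
    have h6 : (1 + (1 + ‖z‖) / |z.im|) * ‖L x‖ =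
        ‖L x‖ + ‖L x‖ / |z.im| + ‖z‖ * (‖L x‖ / |z.im|) := by ring
    rw [h6]
    have h7 : 0 ≤ ‖z‖ * (‖L x‖ / |z.im|) := by positivity
    have h8 := norm_nonneg (L x)
    change max ‖x.1.1‖ ‖x.1.2‖ ≤ _
    exact max_le (by linarith) (by linarith)
  have hcl : IsClosed (Set.range L) := by
    have ha := L.antilipschitz_of_bound (K := ⟨1 + (1 + ‖z‖) / |z.im|, by positivity⟩) hb
    exact ha.isClosed_range L.uniformContinuous
  have hran : (ran (shift T z) : Set H) = Set.range L := by
    ext g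
    rw [SetLike.mem_coe, mem_ran_shift]
    constructor
    · rintro ⟨u, hu⟩
      exact ⟨⟨_, hu⟩, by simp [hL]⟩
    · rintro ⟨⟨⟨a, b⟩, h⟩, rfl⟩
      exact ⟨a, by simpa [hL] using h⟩
  rw [hran] at hdense
  rw [← SetLike.coe_set_eq, hran, Submodule.top_coe, ← hcl.closure_eq]
  exact hdense.closure_eq

/-- A self-adjoint relation without eigenvalues for which `T - z` is not onto for real `z` has the
real line as its spectrum, which is purely continuous. -/
theorem IsSelfAdjoint.spectrum_eq [CompleteSpace H] (hT : IsSelfAdjoint T)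
    (hker : ∀ t : ℝ, ker (shift T t) = ⊥) (hran : ∀ t : ℝ, ran (shift T t) ≠ ⊤) :
    spectrum T = continuousSpectrum T ∧ spectrum T = Set.range ((↑) : ℝ → ℂ) := by
  have h1 : spectrum T = Set.range ((↑) : ℝ → ℂ) := by
    ext z
    constructor
    · intro hz
      refine ⟨z.re, ?_⟩
      by_contra hne
      refine hz (hT.mem_resolventSet fun h => hne ?_)
      exact Complex.ext rfl h.symm
    · rintro ⟨t, rfl⟩ h
      exact hran t h.2
  refine ⟨?_, h1⟩
  apply Set.Subset.antisymm
  · rw [h1]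
    rintro _ ⟨t, rfl⟩
    exact ⟨hker t, hT.dense_ran_shift (by rw [Complex.conj_ofReal]; exact hker t), hran t⟩
  · exact fun z hz h => hz.2.2 h.2

end LinearRelation

namespace PeriodicSystem

open MeasureTheory Set Function Filter Topology
open scoped ComplexConjugate NNReal ENNReal InnerProductSpace

/-! ### Estimates for global solutions -/

section Core

variable {κ : Measure ℝ} {J : ℂ} {p : ℝ → ℝ} {r : ℝ → ℝ≥0} {U u f U' u' f' : ℝ → ℂ}

theorem IsSol.lagrange_withDensity [SigmaFinite κ] (hr : Measurable r) (hJ0 : J ≠ 0)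
    (hJ : J.re = 0) (h : IsSol κ J p (fun t => r t) univ U u f)
    (h' : IsSol κ J p (fun t => r t) univ U' u' f') {a b : ℝ} (hab : a ≤ b) :
    J * (conj (U b) * U' b - conj (U a) * U' a) =
      ∫ t in Ico a b, (conj (u t) * f' t - conj (f t) * u' t)
        ∂(κ.withDensity fun t => r t) := by
  rw [setIntegral_withDensity hr measurableSet_Ico]
  exact h.lagrange ordConnected_univ hJ0 hJ h' trivial trivial hab

theorem IsSol.norm_eq_of_forall_eq_zero {r : ℝ → ℝ} [SigmaFinite κ] (hJ0 : J ≠ 0) (hJ : J.re = 0)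
    (h : IsSol κ J p r univ U u f) {a b : ℝ} (hab : a ≤ b) (hf : ∀ t ∈ Ico a b, f t = 0) :
    ‖U a‖ = ‖U b‖ := by
  have h1 := h.lagrange ordConnected_univ hJ0 hJ h (a := a) (b := b) trivial trivial hab
  rw [setIntegral_congr_fun (g := fun _ => (0 : ℂ)) measurableSet_Ico
    fun t ht => by simp [hf t ht], integral_zero] at h1
  simp only [mul_eq_zero, hJ0, false_or, Complex.conj_mul'] at h1
  rw [sub_eq_zero] at h1
  norm_cast at h1
  exact ((sq_eq_sq₀ (norm_nonneg _) (norm_nonneg _)).1 h1).symm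

/-- Bounded atoms enter here: 2JU = (2J + pκ{t})u - rκ{t}f controls U pointwise by u and f, so L²
information about classes reaches the left limits, for which Lagrange's identity is stated. -/
theorem IsSol.norm_left_le {r : ℝ → ℝ} (hJ0 : J ≠ 0) {C : ℝ} (hp : ∀ t, |p t * κ.real {t}| ≤ C)
    (hr : ∀ t, |r t * κ.real {t}| ≤ C) (h : IsSol κ J p r univ U u f) (t : ℝ) :
    ‖U t‖ ≤ (2 * ‖J‖ + C) / (2 * ‖J‖) * (‖u t‖ + ‖f t‖) := by
  have hJn : 0 < ‖J‖ := norm_pos_iff.2 hJ0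
  have e := h.eq_left hJ0 (t := t) trivial
  have e' : 2 * J * U t = (2 * J + ((p t * κ.real {t} : ℝ) : ℂ)) * u t -
      ((r t * κ.real {t} : ℝ) : ℂ) * f t := by rw [e]; ring
  have hC : 0 ≤ C := (abs_nonneg _).trans (hp 0)
  have h1 : 2 * ‖J‖ * ‖U t‖ ≤ (2 * ‖J‖ + C) * ‖u t‖ + C * ‖f t‖ := by
    calc 2 * ‖J‖ * ‖U t‖ = ‖2 * J * U t‖ := by simp
      _ ≤ ‖(2 * J + ((p t * κ.real {t} : ℝ) : ℂ)) * u t‖ +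
          ‖((r t * κ.real {t} : ℝ) : ℂ) * f t‖ := by rw [e']; exact norm_sub_le _ _
      _ ≤ _ := by
        rw [norm_mul, norm_mul, Complex.norm_real, Real.norm_eq_abs]
        have h2 : ‖2 * J + ((p t * κ.real {t} : ℝ) : ℂ)‖ ≤ 2 * ‖J‖ + C := by
          refine (norm_add_le _ _).trans ?_
          rw [Complex.norm_real, Real.norm_eq_abs, norm_mul, RCLike.norm_ofNat]
          gcongr
          exact hp t
        gcongr
        exact hr t
  rw [div_mul_eq_mul_div, le_div_iff₀ (by positivity)]
  nlinarith [norm_nonneg (u t), norm_nonneg (f t)]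

theorem exists_isSol_at [IsLocallyFiniteMeasure κ] {r : ℝ → ℝ} (hJ0 : J ≠ 0) (hJ : J.re = 0)
    (hpm : Measurable p) {P : ℝ} (hp : ∀ t, |p t| ≤ P) (x₀ : ℝ)
    (hf : ∀ a b, IntegrableOn (fun t => (r t : ℂ) * f t) (Ico a b) κ) :
    ∃ U u, IsSol κ J p r univ U u f ∧ U x₀ = 0 := by
  obtain ⟨U, u, h, -⟩ := exists_isSol hJ0 hJ hpm hp 0 hf
  obtain ⟨V, v, hV, hV0⟩ := exists_isSol (κ := κ) (r := r) (f := 0) hJ0 hJ hpm hp 1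
    fun _ _ => by simp [IntegrableOn]
  have hVx : V x₀ ≠ 0 := by
    have := hV.norm_eq ordConnected_univ hJ0 hJ (a := 0) (b := x₀) trivial trivial
    rw [hV0, norm_one] at this
    exact norm_pos_iff.1 (this ▸ one_pos)
  have hs := h.add (hV.const_mul (-U x₀ / V x₀))
  rw [show (f + fun t => -U x₀ / V x₀ * (0 : ℝ → ℂ) t) = f by ext t; simp] at hs
  refine ⟨_, _, hs, ?_⟩
  simp only [Pi.add_apply]
  field_simp
  ring

/-- A homogeneous solution which vanishes nowhere. -/
theorem exists_isSol_ne_zero [IsLocallyFiniteMeasure κ] {r : ℝ → ℝ} (hJ0 : J ≠ 0) (hJ : J.re = 0)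
    (hpm : Measurable p) {P : ℝ} (hp : ∀ t, |p t| ≤ P) :
    ∃ V v, IsSol κ J p r univ V v 0 ∧ (∀ t, V t ≠ 0) ∧ ∀ t, v t ≠ 0 := by
  obtain ⟨V, v, hV, hV0⟩ := exists_isSol (κ := κ) (r := r) (f := 0) hJ0 hJ hpm hp 1
    fun _ _ => by simp [IntegrableOn]
  have hVx : ∀ t, V t ≠ 0 := fun t => by
    have := hV.norm_eq ordConnected_univ hJ0 hJ (a := 0) (b := t) trivial trivial
    rw [hV0, norm_one] at this
    exact norm_pos_iff.1 (this ▸ one_pos)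
  refine ⟨V, v, hV, hVx, fun t h => ?_⟩
  have := hV.eq_left hJ0 (t := t) trivial
  simp [h, hJ0, hVx t] at this

/-- A nonzero limit would keep G above |L|/2 on a set of the filter, which has infinite measure,
against integrability. -/
theorem eq_zero_of_tendsto_of_le {W : Measure ℝ} {l : Filter ℝ} (hl : ∀ s ∈ l, W s = ∞)
    {B : ℝ → ℂ} {L : ℂ} (hB : Tendsto B l (𝓝 L)) {G : ℝ → ℝ} (hG : Integrable G W)
    (hBG : ∀ x, ‖B x‖ ≤ G x) : L = 0 := by
  by_contra hL
  have hL' := norm_pos_iff.2 hL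
  have h1 := hB.norm.eventually (lt_mem_nhds (half_lt_self hL'))
  exact not_forall_le_of_integrable (hl _ h1) hG (half_pos hL')
    fun x hx => (le_of_lt hx).trans (hBG x)

end Core

/-! ### Symmetry, kernel, range and adjoint of the maximal relation -/

section Relation

variable {q w : RealDistribution} {κ : Measure ℝ} {J : ℂ} {p : ℝ → ℝ} {r : ℝ → ℝ≥0}
  {U u f : ℝ → ℂ}

theorem locallyIntegrable_of_ae_eq {y : LTwo w} (h : y =ᵐ[toMeasure w] f) :
    LocallyIntegrable f (toMeasure w) :=
  (locallyIntegrable_LTwo y).congr h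

theorem IsDensity.integrableOn_rhs (D : IsDensity q w κ p r)
    (hf : LocallyIntegrable f (toMeasure w)) (a b : ℝ) :
    IntegrableOn (fun t => ((r t : ℝ) : ℂ) * f t) (Ico a b) κ := by
  rw [D.toMeasure_eq, locallyIntegrable_withDensity_iff D.measurable_right] at hf
  exact (hf.integrableOn_isCompact isCompact_Icc).mono_set Ico_subset_Icc_self

theorem SolvesEq.congr {g : ℝ → ℂ} (h : SolvesEq J q w u f) (hfg : f =ᵐ[toMeasure w] g) :
    SolvesEq J q w u g := by
  intro φ
  rw [h φ]
  apply integral_congr_ae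
  filter_upwards [hfg] with x hx
  rw [hx]

theorem IsDensity.exists_of_mem_Tmax (D : IsDensity q w κ p r) (hJ0 : J ≠ 0) {x y : LTwo w}
    (h : (x, y) ∈ Tmax J q w) : ∃ U u, x =ᵐ[toMeasure w] u ∧
      ∀ g : ℝ → ℂ, y =ᵐ[toMeasure w] g → IsSol κ J p (fun t => r t) univ U u g := by
  obtain ⟨u, hu, hxu, he⟩ := h
  exact ⟨_, u, hxu, fun g hg => D.isSol hJ0 hu (locallyIntegrable_of_ae_eq hg) (he.congr hg)⟩

theorem IsDensity.mem_Tmax (D : IsDensity q w κ p r) (hJ0 : J ≠ 0) {x y : LTwo w}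
    (hx : x =ᵐ[toMeasure w] u) (hy : y =ᵐ[toMeasure w] f)
    (h : IsSol κ J p (fun t => r t) univ U u f) : (x, y) ∈ Tmax J q w := by
  obtain ⟨h1, -, h2⟩ := D.solvesEq hJ0 (locallyIntegrable_of_ae_eq hy) h
  exact ⟨u, h1, hx, h2.congr hy.symm⟩

theorem LTwo_inner_eq {x y : LTwo w} {f g : ℝ → ℂ} (hx : x =ᵐ[toMeasure w] f)
    (hy : y =ᵐ[toMeasure w] g) : Integrable (fun t => conj (f t) * g t) (toMeasure w) ∧
      ⟪x, y⟫_ℂ = ∫ t, conj (f t) * g t ∂(toMeasure w) := by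
  have e : (fun t => ⟪x t, y t⟫_ℂ) =ᵐ[toMeasure w] fun t => conj (f t) * g t := by
    filter_upwards [hx, hy] with t h1 h2
    rw [h1, h2, RCLike.inner_apply, mul_comm]
  exact ⟨(L2.integrable_inner x y).congr e, by rw [L2.inner_def, integral_congr_ae e]⟩

theorem memLp_of_ae_eq {x : LTwo w} (hx : x =ᵐ[toMeasure w] f) : MemLp f 2 (toMeasure w) :=
  (memLp_congr_ae hx).1 (Lp.memLp x)

/-- The maximal relation is symmetric. -/
theorem IsDensity.symmetric (D : IsDensity q w κ p r) (hJ0 : J ≠ 0) (hJ : J.re = 0) {C : ℝ}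
    (hp : ∀ t, |p t * κ.real {t}| ≤ C) (hr : ∀ t, |r t * κ.real {t}| ≤ C)
    (htop : ∀ X, toMeasure w (Ici X) = ∞ ∧ toMeasure w (Iic X) = ∞)
    {x y x' y' : LTwo w} (h : (x, y) ∈ Tmax J q w) (h' : (x', y') ∈ Tmax J q w) :
    ⟪x, y'⟫_ℂ - ⟪y, x'⟫_ℂ = 0 := by
  have := D.isLocallyFinite
  obtain ⟨U, u, hx, hs⟩ := D.exists_of_mem_Tmax hJ0 h
  obtain ⟨U', u', hx', hs'⟩ := D.exists_of_mem_Tmax hJ0 h'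
  replace hs := hs y EventuallyEq.rfl
  replace hs' := hs' y' EventuallyEq.rfl
  obtain ⟨i1, e1⟩ := LTwo_inner_eq hx (EventuallyEq.refl _ (y' : ℝ → ℂ))
  obtain ⟨i2, e2⟩ := LTwo_inner_eq (EventuallyEq.refl _ (y : ℝ → ℂ)) hx'
  rw [e1, e2, ← integral_sub i1 i2]
  set F : ℝ → ℂ := fun t => conj (u t) * y' t - conj (y t) * u' t
  have hF : Integrable F (toMeasure w) := i1.sub i2
  set B : ℝ → ℂ := fun t => conj (U t) * U' t
  have hB : ∀ a b, a ≤ b → J * (B b - B a) = ∫ t in Ico a b, F t ∂(toMeasure w) := by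
    intro a b hab
    rw [D.toMeasure_eq]
    exact hs.lagrange_withDensity D.measurable_right hJ0 hJ hs' hab
  set K := (2 * ‖J‖ + C) / (2 * ‖J‖)
  have hG : Integrable (fun t => (K * (‖u t‖ + ‖y t‖)) * (K * (‖u' t‖ + ‖y' t‖)))
      (toMeasure w) := by
    have m1 := (((memLp_of_ae_eq hx).norm.add (Lp.memLp y).norm).const_mul K)
    have m2 := (((memLp_of_ae_eq hx').norm.add (Lp.memLp y').norm).const_mul K)
    exact m1.integrable_mul m2
  have hBG : ∀ t, ‖B t‖ ≤ (K * (‖u t‖ + ‖y t‖)) * (K * (‖u' t‖ + ‖y' t‖)) := by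
    intro t
    have h1 := hs.norm_left_le hJ0 hp hr t
    have h2 := hs'.norm_left_le hJ0 hp hr t
    simp only [B, norm_mul, RCLike.norm_conj]
    exact mul_le_mul h1 h2 (norm_nonneg _) ((norm_nonneg _).trans h1)
  have hlim1 : Tendsto B atTop (𝓝 (B 0 + (∫ t in Ici 0, F t ∂(toMeasure w)) / J)) := by
    have := tendsto_setIntegral_of_eventually_mem_iff (l := atTop) (A := fun b : ℝ => Ico 0 b)
      (B := Ici 0) (K := univ) (fun _ => measurableSet_Ico) measurableSet_Ici MeasurableSet.univ
      hF.integrableOn (Filter.Eventually.of_forall fun _ => subset_univ _) fun t => by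
        filter_upwards [eventually_gt_atTop t] with b hb
        simp [hb]
    refine ((this.div_const J).const_add (B 0)).congr' ?_
    filter_upwards [eventually_ge_atTop 0] with b hb
    rw [← hB 0 b hb]
    field_simp
    ring
  have hlim2 : Tendsto B atBot (𝓝 (B 0 - (∫ t in Iio 0, F t ∂(toMeasure w)) / J)) := by
    have := tendsto_setIntegral_of_eventually_mem_iff (l := atBot) (A := fun a : ℝ => Ico a 0)
      (B := Iio 0) (K := univ) (fun _ => measurableSet_Ico) measurableSet_Iio MeasurableSet.univ
      hF.integrableOn (Filter.Eventually.of_forall fun _ => subset_univ _) fun t => by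
        filter_upwards [eventually_lt_atBot t] with b hb
        simp [hb.le]
    refine ((this.div_const J).const_sub (B 0)).congr' ?_
    filter_upwards [eventually_le_atBot 0] with b hb
    rw [← hB b 0 hb]
    field_simp
    ring
  have z1 := eq_zero_of_tendsto_of_le (W := toMeasure w) (l := atTop) (fun s hs => by
    obtain ⟨X, hX⟩ := mem_atTop_sets.1 hs
    exact top_unique ((htop X).1 ▸ measure_mono fun t ht => hX t ht)) hlim1 hG hBG
  have z2 := eq_zero_of_tendsto_of_le (W := toMeasure w) (l := atBot) (fun s hs => by
    obtain ⟨X, hX⟩ := mem_atBot_sets.1 hs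
    exact top_unique ((htop X).2 ▸ measure_mono fun t ht => hX t ht)) hlim2 hG hBG
  -- Vanishing of the two limits says that the integrals of F over the half-lines are -J B(0) and J
  -- B(0), which cancel.
  rw [← integral_add_compl measurableSet_Ici hF (s := Ici 0), compl_Ici]
  field_simp at z1 z2
  linear_combination z1 - z2

/-- An eigenfunction solves the homogeneous equation with p - zr, so |U| is constant. As |U| ≤ K|u|
with u square integrable and w of infinite mass, U = 0, and the relation between U and u gives u =
0. -/
theorem IsDensity.ker_eq_bot (D : IsDensity q w κ p r) (hJ0 : J ≠ 0) (hJ : J.re = 0) {C : ℝ}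
    (hp : ∀ t, |p t * κ.real {t}| ≤ C) (hr : ∀ t, |r t * κ.real {t}| ≤ C)
    (htop : ∀ X, toMeasure w (Ici X) = ∞) (z : ℝ) :
    LinearRelation.ker (LinearRelation.shift (Tmax J q w) z) = ⊥ := by
  have := D.isLocallyFinite
  rw [eq_bot_iff]
  intro x hx
  rw [LinearRelation.mem_ker_shift] at hx
  obtain ⟨U, u, hxu, hs⟩ := D.exists_of_mem_Tmax hJ0 hx
  have hs1 := (hs (fun t => z * u t) (by
    filter_upwards [Lp.coeFn_smul (z : ℂ) x, hxu] with t h1 h2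
    rw [h1, Pi.smul_apply, h2, smul_eq_mul])).shift z
  rw [show (fun t => (z : ℂ) * u t - z * u t) = 0 by ext; simp] at hs1
  have hp' : ∀ t, |(p t - z * r t) * κ.real {t}| ≤ C + |z| * C := fun t => by
    rw [sub_mul, mul_assoc]
    refine (abs_sub _ _).trans (add_le_add (hp t) ?_)
    rw [abs_mul]
    exact mul_le_mul_of_nonneg_left (hr t) (abs_nonneg _)
  have hC : 0 ≤ C := (abs_nonneg _).trans (hp 0)
  have hr' : ∀ t, |r t * κ.real {t}| ≤ C + |z| * C := fun t =>
    (hr t).trans (le_add_of_nonneg_right (by positivity))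
  have hU : ∀ t, U t = 0 := by
    by_contra! hne
    obtain ⟨t₀, ht₀⟩ := hne
    set K := (2 * ‖J‖ + (C + |z| * C)) / (2 * ‖J‖)
    have hi : Integrable (fun t => (K * ‖u t‖) * (K * ‖u t‖)) (toMeasure w) :=
      ((memLp_of_ae_eq hxu).norm.const_mul K).integrable_mul ((memLp_of_ae_eq hxu).norm.const_mul K)
    have hpos := norm_pos_iff.2 ht₀
    refine not_forall_le_of_integrable (htop 0) hi (mul_pos hpos hpos) fun t _ => ?_
    have h1 := hs1.norm_left_le hJ0 hp' hr' t
    rw [hs1.norm_eq ordConnected_univ hJ0 hJ (a := t) (b := t₀) trivial trivial] at h1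
    simp only [Pi.zero_apply, norm_zero, add_zero] at h1
    gcongr
  rw [Submodule.mem_bot, Lp.eq_zero_iff_ae_eq_zero]
  filter_upwards [hxu] with t ht
  have := hs1.eq_left hJ0 (t := t) trivial
  simp only [hU, Pi.zero_apply, mul_zero, add_zero, mul_eq_zero,
    two_mul_add_ne_zero hJ0 hJ, false_or] at this
  rw [ht, this, Pi.zero_apply]

theorem exists_measure_Ico_ne_zero {W : Measure ℝ} (h : W (Ici 0) = ∞) :
    ∃ N : ℕ, W (Ico (-N : ℝ) N) ≠ 0 := by
  by_contra! hz
  have hU : (⋃ N : ℕ, Ico (-N : ℝ) N) = univ := by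
    refine eq_univ_of_forall fun x => mem_iUnion.2 ?_
    obtain ⟨N, hN⟩ := exists_nat_gt |x|
    have := abs_lt.1 hN
    exact ⟨N, this.1.le, this.2⟩
  have h0 : W univ = 0 := by rw [← hU, measure_iUnion_null_iff]; exact hz
  have h1 : W (Ici 0) ≤ W univ := measure_mono (subset_univ _)
  rw [h, h0] at h1
  simp at h1

theorem IsBalancedBV.memLp_indicator (hu : IsBalancedBV u) (W : Measure ℝ)
    [IsLocallyFiniteMeasure W] (a b : ℝ) : MemLp ((Ico a b).indicator u) 2 W := by
  obtain ⟨M, hM⟩ := hu.exists_norm_le a b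
  rw [memLp_indicator_iff_restrict measurableSet_Ico]
  have : IsFiniteMeasure (W.restrict (Ico a b)) :=
    isFiniteMeasure_restrict.2 (measure_Ico_ne_top W _ _)
  refine MemLp.of_bound hu.measurable.aestronglyMeasurable M ?_
  filter_upwards [ae_restrict_mem measurableSet_Ico] with t ht
  exact hM t (Ico_subset_Icc_self ht)

/-- The element missed by the range is a homogeneous solution v cut off to an interval [a,b) charged
by w. Outside it a preimage has constant |U| on either side, so square integrability forces U(a) =
U(b) = 0, and Lagrange's identity with v then says that v has zero norm there. -/
theorem IsDensity.ran_ne_top (D : IsDensity q w κ p r) (hJ0 : J ≠ 0) (hJ : J.re = 0) {C : ℝ}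
    (hp : ∀ t, |p t * κ.real {t}| ≤ C) (hr : ∀ t, |r t * κ.real {t}| ≤ C)
    (htop : ∀ X, toMeasure w (Ici X) = ∞ ∧ toMeasure w (Iic X) = ∞) (z : ℝ) :
    LinearRelation.ran (LinearRelation.shift (Tmax J q w) z) ≠ ⊤ := by
  have := D.isLocallyFinite
  intro hran
  have hC : 0 ≤ C := (abs_nonneg _).trans (hp 0)
  have hp' : ∀ t, |(p t - z * r t) * κ.real {t}| ≤ C + |z| * C := fun t => by
    rw [sub_mul, mul_assoc]
    refine (abs_sub _ _).trans (add_le_add (hp t) ?_)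
    rw [abs_mul]
    exact mul_le_mul_of_nonneg_left (hr t) (abs_nonneg _)
  have hr' : ∀ t, |r t * κ.real {t}| ≤ C + |z| * C := fun t =>
    (hr t).trans (le_add_of_nonneg_right (by positivity))
  obtain ⟨V, v, hV, -, hv0⟩ := exists_isSol_ne_zero (κ := κ) (p := fun t => p t - z * r t)
    (r := fun t => r t) hJ0 hJ (D.measurable_left.sub
      (D.measurable_right.coe_nnreal_real.const_mul z)) (P := 1 + |z|) fun t => by
      refine (abs_sub _ _).trans (add_le_add (D.abs_left_le t) ?_)
      rw [abs_mul, NNReal.abs_eq]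
      exact mul_le_of_le_one_right (abs_nonneg _) (D.right_le t)
  have hvBV := (hV.isPrim.isBalancedBV fun t => hV.eq t trivial).1
  obtain ⟨a, b, hab, hN⟩ : ∃ a b : ℝ, a ≤ b ∧ toMeasure w (Ico a b) ≠ 0 := by
    obtain ⟨N, hN⟩ := exists_measure_Ico_ne_zero (htop 0).1
    exact ⟨_, _, by linarith [Nat.cast_nonneg (α := ℝ) N], hN⟩
  set f := (Ico a b).indicator v
  have hf := hvBV.memLp_indicator (toMeasure w) a b
  obtain ⟨x, hx⟩ := LinearRelation.mem_ran_shift.1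
    (show hf.toLp f ∈ LinearRelation.ran (LinearRelation.shift (Tmax J q w) z) from
      hran ▸ Submodule.mem_top)
  obtain ⟨U, u, hxu, hs⟩ := D.exists_of_mem_Tmax hJ0 hx
  have hs1 := (hs (fun t => f t + z * u t) (by
    filter_upwards [Lp.coeFn_add (hf.toLp f) ((z : ℂ) • x), Lp.coeFn_smul (z : ℂ) x, hxu,
      hf.coeFn_toLp] with t h1 h2 h3 h4
    rw [h1, Pi.add_apply, h2, Pi.smul_apply, h3, h4, smul_eq_mul])).shift z
  rw [show (fun t => f t + (z : ℂ) * u t - z * u t) = f by ext; simp] at hs1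
  set K := (2 * ‖J‖ + (C + |z| * C)) / (2 * ‖J‖)
  have hi : Integrable (fun t => (K * ‖u t‖) * (K * ‖u t‖)) (toMeasure w) :=
    ((memLp_of_ae_eq hxu).norm.const_mul K).integrable_mul ((memLp_of_ae_eq hxu).norm.const_mul K)
  have hle : ∀ t, f t = 0 → ‖U t‖ ≤ K * ‖u t‖ := fun t ht => by
    have h1 := hs1.norm_left_le hJ0 hp' hr' t
    rwa [ht, norm_zero, add_zero] at h1
  have hfz : ∀ t, t ∉ Ico a b → f t = 0 := fun t ht => indicator_of_notMem ht _
  have hUb : U b = 0 := by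
    by_contra hne
    have hpos := norm_pos_iff.2 hne
    refine not_forall_le_of_integrable (htop b).1 hi (mul_pos hpos hpos) fun t ht => ?_
    have h1 := hle t (hfz t fun h => ht.not_gt h.2)
    rw [← hs1.norm_eq_of_forall_eq_zero hJ0 hJ ht
      fun s hs => hfz s fun h => hs.1.not_gt h.2] at h1
    gcongr
  have hUa : U a = 0 := by
    by_contra hne
    have hpos := norm_pos_iff.2 hne
    -- The point a itself belongs to [a,b), where f need not vanish; the half-line up to a - 1 stays
    -- strictly to the left.
    refine not_forall_le_of_integrable (htop (a - 1)).2 hi (mul_pos hpos hpos) fun t ht => ?_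
    have hta : t < a := lt_of_le_of_lt ht (by linarith)
    have h1 := hle t (hfz t fun h => hta.not_ge h.1)
    rw [hs1.norm_eq_of_forall_eq_zero hJ0 hJ hta.le
      fun s hs => hfz s fun h => hs.2.not_ge h.1] at h1
    gcongr
  have hL := hV.lagrange_withDensity D.measurable_right hJ0 hJ hs1 hab
  rw [hUa, hUb, ← D.toMeasure_eq, setIntegral_congr_fun
    (g := fun t => ((‖v t‖ ^ 2 : ℝ) : ℂ)) measurableSet_Ico fun t ht => by
      simp [f, indicator_of_mem ht, Complex.conj_mul'], integral_complex_ofReal] at hL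
  simp only [mul_zero, sub_zero] at hL
  have hL' : ∫ t in Ico a b, ‖v t‖ ^ 2 ∂(toMeasure w) = 0 := by exact_mod_cast hL.symm
  have hint : IntegrableOn (fun t => ‖v t‖ ^ 2) (Ico a b) (toMeasure w) :=
    ((memLp_indicator_iff_restrict measurableSet_Ico).1 hf).norm.integrable_sq
  rw [setIntegral_eq_zero_iff_of_nonneg_ae (ae_of_all _ fun t => sq_nonneg _) hint] at hL'
  have hF : ∀ᵐ t ∂(toMeasure w).restrict (Ico a b), False := by
    filter_upwards [hL'] with t ht
    exact hv0 t (by simpa using ht)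
  rw [eventually_false_iff_eq_bot, ae_eq_bot, Measure.restrict_eq_zero] at hF
  exact hN hF

/-- Subtracting from P its projection onto e leaves a vector of M orthogonal to e, hence orthogonal
to P, hence to itself. -/
theorem eq_smul_of_forall_inner {H : Type*} [NormedAddCommGroup H] [InnerProductSpace ℂ H]
    {M : Submodule ℂ H} {e P : H} (he : e ∈ M) (hP : P ∈ M)
    (h : ∀ g ∈ M, ⟪e, g⟫_ℂ = 0 → ⟪g, P⟫_ℂ = 0) : ∃ c : ℂ, P = c • e := by
  -- For e = 0 the quotient is 0 by the convention for division, and the argument still applies.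
  refine ⟨⟪e, P⟫_ℂ / ⟪e, e⟫_ℂ, ?_⟩
  set c := ⟪e, P⟫_ℂ / ⟪e, e⟫_ℂ
  have h1 : ⟪e, P - c • e⟫_ℂ = 0 := by
    rw [inner_sub_right, inner_smul_right]
    rcases eq_or_ne e 0 with rfl | he0
    · simp
    · rw [div_mul_cancel₀ _ (inner_self_ne_zero.2 he0), sub_self]
  have h2 := h _ (M.sub_mem hP (M.smul_mem c he)) h1
  have h3 : ⟪P - c • e, P - c • e⟫_ℂ = 0 := by
    rw [inner_sub_right, h2, inner_smul_right, ← inner_conj_symm, h1]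
    simp
  exact sub_eq_zero.1 (inner_self_eq_zero.1 h3)

/-- The classes in `L²(w)` which vanish outside of `S`. -/
noncomputable def vanishingOutside (w : RealDistribution) (S : Set ℝ) : Submodule ℂ (LTwo w) where
  carrier := {g | ∀ᵐ t ∂(toMeasure w), t ∉ S → g t = 0}
  zero_mem' := by
    filter_upwards [Lp.coeFn_zero ℂ 2 (toMeasure w)] with t ht _
    rw [ht, Pi.zero_apply]
  add_mem' := fun {f g} hf hg => by
    have hf' : ∀ᵐ t ∂(toMeasure w), t ∉ S → f t = 0 := hf
    have hg' : ∀ᵐ t ∂(toMeasure w), t ∉ S → g t = 0 := hg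
    have h : ∀ᵐ t ∂(toMeasure w), t ∉ S → (f + g) t = 0 := by
      filter_upwards [Lp.coeFn_add f g, hf', hg'] with t h1 h2 h3 ht
      rw [h1, Pi.add_apply, h2 ht, h3 ht, add_zero]
    exact h
  smul_mem' := fun c f hf => by
    have hf' : ∀ᵐ t ∂(toMeasure w), t ∉ S → f t = 0 := hf
    have h : ∀ᵐ t ∂(toMeasure w), t ∉ S → (c • f) t = 0 := by
      filter_upwards [Lp.coeFn_smul c f, hf'] with t h1 h2 ht
      rw [h1, Pi.smul_apply, h2 ht, smul_zero]
    exact h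

theorem mem_vanishingOutside {S : Set ℝ} {g : LTwo w} :
    g ∈ vanishingOutside w S ↔ ∀ᵐ t ∂(toMeasure w), t ∉ S → g t = 0 := Iff.rfl

theorem toLp_indicator_mem {S : Set ℝ} (hf : MemLp (S.indicator f) 2 (toMeasure w)) :
    hf.toLp _ ∈ vanishingOutside w S := by
  rw [mem_vanishingOutside]
  filter_upwards [hf.coeFn_toLp] with t h1 h2
  rw [h1, indicator_of_notMem h2]

/-- If `g` vanishes outside of `[a, b)` and is orthogonal there to the homogeneous solution `v`, then
the solution with right-hand side `g` can be chosen to vanish outside of `[a, b)`. -/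
theorem IsDensity.exists_mem_Tmax_of_orthogonal (D : IsDensity q w κ p r) (hJ0 : J ≠ 0)
    (hJ : J.re = 0) {V v : ℝ → ℂ} (hV : IsSol κ J p (fun t => r t) univ V v 0)
    (hV0 : ∀ t, V t ≠ 0) {a b : ℝ} (hab : a ≤ b) {g : LTwo w}
    (hg : g ∈ vanishingOutside w (Ico a b))
    (hvg : ∫ t in Ico a b, conj (v t) * g t ∂(toMeasure w) = 0) :
    ∃ x : LTwo w, (x, g) ∈ Tmax J q w ∧ ∀ U₁ u₁ : ℝ → ℂ, ∀ h : LTwo w,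
      IsSol κ J p (fun t => r t) univ U₁ u₁ h →
      ⟪x, h⟫_ℂ = ∫ t in Ico a b, conj (g t) * u₁ t ∂(toMeasure w) := by
  have := D.isLocallyFinite
  set f := (Ico a b).indicator g
  have hgf : g =ᵐ[toMeasure w] f := by
    filter_upwards [mem_vanishingOutside.1 hg] with t ht
    by_cases h : t ∈ Ico a b
    · exact (indicator_of_mem h _).symm
    · exact (ht h).trans (indicator_of_notMem h _).symm
  have hfz : ∀ t, t ∉ Ico a b → f t = 0 := fun t ht => indicator_of_notMem ht _
  obtain ⟨U, u, hU, hUa⟩ := exists_isSol_at hJ0 hJ D.measurable_left D.abs_left_le a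
    (r := fun t => r t) (f := f) (D.integrableOn_rhs (locallyIntegrable_of_ae_eq hgf))
  have hL := hV.lagrange_withDensity D.measurable_right hJ0 hJ hU hab
  rw [← D.toMeasure_eq, setIntegral_congr_fun (g := fun t => conj (v t) * g t) measurableSet_Ico
    fun t ht => by simp [f, indicator_of_mem ht], hvg, hUa] at hL
  -- With U(a) = 0 and g orthogonal to v, Lagrange's identity reads J conj(V(b)) U(b) = 0.
  have hUb : U b = 0 := by simpa [hJ0, hV0 b] using hL
  have hUz : ∀ t, t ∉ Ico a b → U t = 0 := by
    intro t ht
    rcases lt_or_ge t a with h | h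
    · have := hU.norm_eq_of_forall_eq_zero hJ0 hJ h.le
        fun s hs => hfz s fun h' => hs.2.not_ge h'.1
      rw [hUa, norm_zero] at this
      exact norm_eq_zero.1 this
    · have hbt : b ≤ t := not_lt.1 fun h' => ht ⟨h, h'⟩
      have := hU.norm_eq_of_forall_eq_zero hJ0 hJ hbt
        fun s hs => hfz s fun h' => hs.1.not_gt h'.2
      rw [hUb, norm_zero] at this
      exact norm_eq_zero.1 this.symm
  have huz : ∀ t, t ∉ Ico a b → u t = 0 := by
    intro t ht
    have := hU.eq_left hJ0 (t := t) trivial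
    simpa only [hUz t ht, hfz t ht, mul_zero, add_zero, mul_eq_zero,
      two_mul_add_ne_zero hJ0 hJ, false_or] using this
  have hui : (Ico a b).indicator u = u := by
    ext t
    by_cases h : t ∈ Ico a b
    · rw [indicator_of_mem h]
    · rw [indicator_of_notMem h, huz t h]
  have huL := (hU.isPrim.isBalancedBV fun t => hU.eq t trivial).1.memLp_indicator (toMeasure w) a b
  rw [hui] at huL
  refine ⟨huL.toLp u, D.mem_Tmax hJ0 huL.coeFn_toLp hgf hU, fun U₁ u₁ h h₁ => ?_⟩
  -- U vanishes at both endpoints, so there is no boundary term. This is why the solution paired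
  -- with x need not be in L².
  have hL1 := hU.lagrange_withDensity D.measurable_right hJ0 hJ h₁ hab
  rw [hUa, hUb, ← D.toMeasure_eq] at hL1
  obtain ⟨i1, e1⟩ := LTwo_inner_eq huL.coeFn_toLp (EventuallyEq.refl _ (h : ℝ → ℂ))
  rw [e1, ← setIntegral_eq_integral_of_forall_compl_eq_zero (s := Ico a b)
    fun t ht => by rw [huz t ht, map_zero, zero_mul]]
  have hu₁ := (h₁.isPrim.isBalancedBV fun t => h₁.eq t trivial).1.memLp_indicator
    (toMeasure w) a b
  have i2 : IntegrableOn (fun t => conj (g t) * u₁ t) (Ico a b) (toMeasure w) :=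
    ((Lp.memLp g).star.restrict (Ico a b)).integrable_mul
      ((memLp_indicator_iff_restrict measurableSet_Ico).1 hu₁)
  rw [setIntegral_congr_fun (g := fun t => conj (u t) * h t - conj (g t) * u₁ t) measurableSet_Ico
    fun t ht => by simp [f, indicator_of_mem ht], integral_sub i1.integrableOn i2] at hL1
  simp only [map_zero, zero_mul, sub_zero, mul_zero] at hL1
  exact sub_eq_zero.1 hL1.symm

/-- Let u₁ be any solution with right-hand side h. Pairing with the compactly supported elements of
Tmax shows that on each interval φ - u₁ is orthogonal to everything orthogonal to v, hence is a
multiple of v there. One multiple serves the whole line, so φ is a.e. the solution u₁ + cv. -/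
theorem IsDensity.mem_Tmax_of_forall_inner (D : IsDensity q w κ p r) (hJ0 : J ≠ 0) (hJ : J.re = 0)
    (htop : ∀ X, toMeasure w (Ici X) = ∞) {φ h : LTwo w}
    (hφ : ∀ a b, (a, b) ∈ Tmax J q w → ⟪b, φ⟫_ℂ - ⟪a, h⟫_ℂ = 0) : (φ, h) ∈ Tmax J q w := by
  have := D.isLocallyFinite
  obtain ⟨U₁, u₁, h₁, -⟩ := exists_isSol_at hJ0 hJ D.measurable_left D.abs_left_le 0
    (r := fun t => r t) (f := h) (D.integrableOn_rhs (locallyIntegrable_LTwo h))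
  obtain ⟨V, v, hV, hV0, hv0⟩ := exists_isSol_ne_zero (κ := κ) (p := p) (r := fun t => r t)
    hJ0 hJ D.measurable_left D.abs_left_le
  have hu₁BV := (h₁.isPrim.isBalancedBV fun t => h₁.eq t trivial).1
  have hvBV := (hV.isPrim.isBalancedBV fun t => hV.eq t trivial).1
  have loc : ∀ a b : ℝ, a ≤ b → ∃ c : ℂ, ∀ᵐ t ∂(toMeasure w), t ∈ Ico a b →
      φ t - u₁ t = c * v t := by
    intro a b hab
    set S := Ico a b
    have hvS := hvBV.memLp_indicator (toMeasure w) a b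
    have huS := hu₁BV.memLp_indicator (toMeasure w) a b
    have hψS : MemLp (S.indicator fun t => φ t - u₁ t) 2 (toMeasure w) := by
      have := ((Lp.memLp φ).indicator (s := S) measurableSet_Ico).sub huS
      convert this using 1
      ext t
      by_cases ht : t ∈ S <;> simp [ht, S]
    obtain ⟨c, hc⟩ := eq_smul_of_forall_inner (toLp_indicator_mem hvS) (toLp_indicator_mem hψS)
      fun g hg hvg => by
        obtain ⟨i1, e1⟩ := LTwo_inner_eq hvS.coeFn_toLp (EventuallyEq.refl _ (g : ℝ → ℂ))
        rw [e1, ← setIntegral_eq_integral_of_forall_compl_eq_zero (s := S)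
          fun t ht => by rw [indicator_of_notMem ht, map_zero, zero_mul],
          setIntegral_congr_fun (g := fun t => conj (v t) * g t) measurableSet_Ico
          fun t ht => by simp only [indicator_of_mem ht]] at hvg
        obtain ⟨x, hx, hx'⟩ := D.exists_mem_Tmax_of_orthogonal hJ0 hJ hV hV0 hab hg hvg
        have h2 := hφ x g hx
        rw [hx' U₁ u₁ h h₁] at h2
        obtain ⟨i2, e2⟩ := LTwo_inner_eq (EventuallyEq.refl _ (g : ℝ → ℂ))
          (EventuallyEq.refl _ (φ : ℝ → ℂ))
        obtain ⟨i3, e3⟩ := LTwo_inner_eq (EventuallyEq.refl _ (g : ℝ → ℂ)) hψS.coeFn_toLp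
        have i4 : IntegrableOn (fun t => conj (g t) * u₁ t) S (toMeasure w) :=
          ((Lp.memLp g).star.restrict S).integrable_mul
            ((memLp_indicator_iff_restrict measurableSet_Ico).1 huS)
        have e4 : ∫ t, conj (g t) * φ t ∂(toMeasure w) =
            ∫ t in S, conj (g t) * φ t ∂(toMeasure w) := by
          symm
          apply setIntegral_eq_integral_of_ae_compl_eq_zero
          filter_upwards [mem_vanishingOutside.1 hg] with t ht hts
          rw [ht hts, map_zero, zero_mul]
        rw [e3, ← setIntegral_eq_integral_of_forall_compl_eq_zero (s := S)
          fun t ht => by rw [indicator_of_notMem ht, mul_zero],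
          setIntegral_congr_fun (g := fun t => conj (g t) * φ t - conj (g t) * u₁ t)
          measurableSet_Ico fun t ht => by rw [indicator_of_mem (s := S) ht, mul_sub],
          integral_sub i2.integrableOn i4, ← e4, ← e2, h2]
    refine ⟨c, ?_⟩
    have hc' := hψS.coeFn_toLp
    rw [hc] at hc'
    filter_upwards [hc', hvS.coeFn_toLp, Lp.coeFn_smul c (hvS.toLp _)] with t h1 h2 h3 ht
    rw [h3, Pi.smul_apply, h2, indicator_of_mem ht, indicator_of_mem ht, smul_eq_mul] at h1
    exact h1.symm
  obtain ⟨N, hN⟩ := exists_measure_Ico_ne_zero (htop 0)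
  choose c hc using fun n : ℕ => loc (-n : ℝ) n (by linarith [Nat.cast_nonneg (α := ℝ) n])
  -- Both multiples represent φ - u₁ on [-N, N), which w charges, and v vanishes nowhere; different
  -- constants would make this interval null.
  have hcN : ∀ n, N ≤ n → c n = c N := by
    intro n hn
    have hn' : (N : ℝ) ≤ n := by exact_mod_cast hn
    by_contra hne
    apply hN
    rw [← nonpos_iff_eq_zero, ← (ae_iff.1 ((hc n).and (hc N)))]
    refine measure_mono fun t ht hcon => hne ?_
    have h1 := hcon.1 ⟨by linarith [ht.1], by linarith [ht.2]⟩
    rw [hcon.2 ht] at h1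
    exact (mul_right_cancel₀ (hv0 t) h1).symm
  have hae : φ =ᵐ[toMeasure w] u₁ + fun t => c N * v t := by
    filter_upwards [ae_all_iff.2 hc] with t ht
    obtain ⟨m, hm⟩ := exists_nat_gt |t|
    have hm' : |t| < (max m N : ℕ) := hm.trans_le (by exact_mod_cast le_max_left _ _)
    rw [abs_lt] at hm'
    have := ht (max m N) ⟨hm'.1.le, hm'.2⟩
    rw [hcN _ (le_max_right _ _)] at this
    rw [Pi.add_apply, ← this]
    ring
  have hsol := h₁.add (hV.const_mul (c N))
  rw [show ((h : ℝ → ℂ) + fun t => c N * (0 : ℝ → ℂ) t) = h by ext; simp] at hsol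
  exact D.mem_Tmax hJ0 hae EventuallyEq.rfl hsol

end Relation

end PeriodicSystem

theorem theorem5p2 (ω : ℝ) (hω : 0 < ω) (J : ℂ) (hJ : J ≠ 0) (hJim : J.re = 0)
    (q w : PeriodicSystem.RealDistribution)
    (hq : PeriodicSystem.HasOrderZero q) (hw : PeriodicSystem.HasOrderZero w)
    (hqω : PeriodicSystem.HasPeriod q ω) (hwω : PeriodicSystem.HasPeriod w ω)
    (hw_nonneg : PeriodicSystem.IsNonneg w) (hw_ne : w ≠ 0) :
    LinearRelation.IsSelfAdjoint (PeriodicSystem.Tmax J q w) ∧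
    LinearRelation.spectrum (PeriodicSystem.Tmax J q w) =
      LinearRelation.continuousSpectrum (PeriodicSystem.Tmax J q w) ∧
    LinearRelation.spectrum (PeriodicSystem.Tmax J q w) = Set.range ((↑) : ℝ → ℂ) := by
  obtain ⟨κ, p, r, D⟩ := PeriodicSystem.exists_isDensity q w
  obtain ⟨C₁, hC₁⟩ := PeriodicSystem.exists_jordanPair_atom_bound hω hq hqω
  obtain ⟨C₂, hC₂⟩ := PeriodicSystem.exists_toMeasure_atom_bound hω hw hwω hw_nonneg
  have htop := PeriodicSystem.toMeasure_Ici_Iic_eq_top hω hwω hw_nonneg hw_ne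
  have hp : ∀ t, |p t * κ.real {t}| ≤ max C₁ C₂ := fun t => by
    rw [D.atom_eq]
    exact (hC₁ t).trans (le_max_left _ _)
  have hr : ∀ t, |r t * κ.real {t}| ≤ max C₁ C₂ := fun t => by
    rw [← PeriodicSystem.withDensity_real_singleton, ← D.toMeasure_eq,
      abs_of_nonneg MeasureTheory.measureReal_nonneg]
    exact (hC₂ t).trans (le_max_right _ _)
  have hT : LinearRelation.IsSelfAdjoint (PeriodicSystem.Tmax J q w) := by
    ext ⟨φ, h⟩
    rw [Submodule.mem_adjoint_iff]
    refine ⟨D.mem_Tmax_of_forall_inner hJ hJim fun X => (htop X).1, fun hφ a b hab => ?_⟩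
    rw [← neg_sub, D.symmetric hJ hJim hp hr htop hab hφ, neg_zero]
  exact ⟨hT, hT.spectrum_eq (D.ker_eq_bot hJ hJim hp hr fun X => (htop X).1)
    (D.ran_ne_top hJ hJim hp hr htop)⟩
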